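/- Let $B$ be an $m$-dimensional tropical manifold: a smooth manifold with an atlas $\{(U_\lambda,\psi_\lambda)\}$ whose transition functions lie in $\mathbb{R}^m\rtimes GL(\mathbb{Z}^m)$; write $x=(x_1,\dots,x_m)=\psi_\lambda$. Let $K=\{K_\lambda\}$ be a convex multi-valued function on $B$: each $K_\lambda$ is smooth on $U_\lambda$ with positive definite Hessian in the coordinates $x$, and $K_\lambda-K_\mu$ is affine linear in $x$ on $U_\lambda\cap U_\mu$. Put $\tilde x_i=\partial K_\lambda/\partial x_i$. Let $X(B)=TB/\Lambda$ with $\Lambda=\bigoplus_i\mathbb{Z}\,\partial/\partial x_i$, holomorphic coordinates $z_i=x_i+\sqrt{-1}y_i$ ($y_i$ the coefficient of $\partial/\partial x_i$), Kähler form $\omega=\frac{\sqrt{-1}}{2}\sum_{i,j}\frac{\partial^2K_\lambda}{\partial x_i\partial x_j}dz_i\wedge d\bar z_j$ and holomorphic volume form $\Omega=dz_1\wedge\dots\wedge dz_m$. Let $W(B)=T^*B/\Lambda^*$ with $\Lambda^*=\bigoplus_i\mathbb{Z}\,dx_i$, holomorphic coordinates $\tilde z_i=\tilde x_i+\sqrt{-1}\tilde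 y_i$ ($\tilde y_i$ the coefficient of $dx_i$) and Kähler form $\tilde\omega=\sum_i dx_i\wedge d\tilde y_i$. Let $0\le k\le m$. A $k$-dimensional affine subspace of $\mathbb{R}^m$ is rational if it has the form $\mathbb{R}\xi_1+\dots+\mathbb{R}\xi_k+a$, where $\xi_1,\dots,\xi_k$ are part of a basis of $\mathbb{Z}^m$ and $a\in\mathbb{R}^m$. Let $V$ be a constant section of the bundle of $k$-dimensional rational affine subspaces, that is, a family of such subspaces $V_\lambda$, one for each $\lambda$, with $V_\lambda=A(\lambda,\mu)V_\mu+b(\lambda,\mu)$ whenever $U_\lambda\cap U_\mu\ne\emptyset$, where $A(\lambda,\mu)$ is the matrix with entry $\partial x_i^\mu/\partial x_j^\lambda$ in row $j$ and column $i$, and $b(\lambda,\mu)_j=\partial(K_\lambda-K_\mu)/\partial x_j^\lambda$. Let $\overline V_\lambda$ be the linear part of $V_\lambda$ and $\overline V_\lambda^{\perp}=\{w\in\mathbb{R}^m:\sum_i v_iw_i=0\text{ for all }v\in\overline V_\lambda\}$. Put $$B(V)=\bigcup_\lambda\{p\in U_\lambda:\tilde x(p)\in V_\lambda\},$$ and let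 $Y=\sum_jY_j\,\partial/\partial x_j$ be a smooth section of $TB|_{B(V)}$. Define $$L(V,Y)=\Big\{\Big[\sum_i w_i\tfrac{\partial}{\partial x_i}+Y(p)\Big]: p\in B(V)\cap U_\lambda,\ w\in\overline V_\lambda^{\perp}\Big\}\subset X(B),$$ $$C(V)=\Big\{\Big[\sum_i w_i\,dx_i\Big]: p\in B(V)\cap U_\lambda,\ w\in\overline V_\lambda\Big\}\subset W(B),$$ and the Hermitian connection $D^Y=d+\sqrt{-1}\sum_jY_j\,d\tilde y_j$, with curvature $F=d\big(\sqrt{-1}\sum_jY_j\,d\tilde y_j\big)$, on the trivial line bundle $\underline{\mathbb{C}}\to C(V)$. An $m$-dimensional real submanifold $L\subset X(B)$ is Lagrangian if $\omega|_L=0$, and special Lagrangian with phase $e^{\sqrt{-1}\theta}$ if moreover $\operatorname{Im}(e^{-\sqrt{-1}\theta}\Omega)|_L=0$. The connection $D^Y$ is integrable if $F^{(0,2)}=0$, and deformed Hermitian Yang–Mills with phase $e^{\sqrt{-1}\theta}$ if moreover $\operatorname{Im}\big(e^{-\sqrt{-1}\theta}(\tilde\omega+F)^k\big)=0$ on $C(V)$.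 Theorem. $L(V,Y)$ is an $m$-dimensional submanifold of $X(B)$ and $C(V)$ is a complex submanifold of $W(B)$ of complex dimension $k$. $L(V,Y)$ is Lagrangian if and only if $D^Y$ is integrable. Furthermore, for every $\theta\in\mathbb{R}$, $L(V,Y)$ is special Lagrangian with phase $(\sqrt{-1})^{m-k}e^{\sqrt{-1}\theta}$ if and only if $D^Y$ is a deformed Hermitian Yang–Mills connection with phase $e^{\sqrt{-1}\theta}$. In particular, if $m-k$ is even, then $L(V,Y)$ is special Lagrangian with phase $e^{\sqrt{-1}\theta}$ if and only if $D^Y$ is a deformed Hermitian Yang–Mills connection with phase $e^{\sqrt{-1}\theta}$. -/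

import Mathlib

open scoped ContDiff Manifold Matrix

namespace TropicalMirror

noncomputable section

/-! ## Differential geometry in a real normed space -/

/-- `φ : O → E` is a smooth local parametrization of the subset `S` of `E`: an injective immersion of
an open set `O` which is a homeomorphism onto a relatively open subset of `S`. -/
structure IsLocalParam {P E : Type*} [NormedAddCommGroup P] [NormedSpace ℝ P]
    [NormedAddCommGroup E] [NormedSpace ℝ E] (S : Set E) (O : Set P) (φ : P → E) : Prop where
  isOpen : IsOpen O
  smooth : ContDiffOn ℝ ∞ φ O
  mapsTo : Set.MapsTo φ O S
  injOn : Set.InjOn φ O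
  immersion : ∀ u ∈ O, Function.Injective (fderiv ℝ φ u)
  isOpen_image : ∀ O' ⊆ O, IsOpen O' → ∃ U : Set E, IsOpen U ∧ φ '' O' = S ∩ U

/-- `S` is an embedded smooth `d`-dimensional submanifold of `E`. -/
def IsSubmanifold {E : Type*} [NormedAddCommGroup E] [NormedSpace ℝ E] (d : ℕ) (S : Set E) : Prop :=
  ∀ p ∈ S, ∃ (O : Set (Fin d → ℝ)) (φ : (Fin d → ℝ) → E), IsLocalParam S O φ ∧ p ∈ φ '' O

/-- A complex valued real `1`-form, regarded as an alternating form of degree one. -/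
def toForm {P : Type*} [NormedAddCommGroup P] [NormedSpace ℝ P] (α : P →L[ℝ] ℂ) :
    P [⋀^Fin 1]→L[ℝ] ℂ :=
  ContinuousAlternatingMap.ofSubsingleton ℝ P ℂ (0 : Fin 1) α

/-- The curvature `2`-form `F = dα` of the connection `d + α` on the trivial complex line bundle. -/
def curvature {P : Type*} [NormedAddCommGroup P] [NormedSpace ℝ P] (α : P → P →L[ℝ] ℂ) (u : P)
    (a b : P) : ℂ :=
  extDeriv (fun u' => toForm (α u')) u ![a, b]

/-- The `(0,2)`-part of a complex valued `2`-form `β` at a point of `ℂᵏ`: the value of the complex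
bilinear extension of `β` on the `(0,1)`-parts `(a + √-1 J a)/2` and `(b + √-1 J b)/2`. -/
def part02 {k : ℕ} (β : (Fin k → ℂ) → (Fin k → ℂ) → ℂ) (a b : Fin k → ℂ) : ℂ :=
  (1 / 4) * (β a b + Complex.I * β (Complex.I • a) b + Complex.I * β a (Complex.I • b)
    - β (Complex.I • a) (Complex.I • b))

/-- The `k`-fold wedge power `β ∧ ⋯ ∧ β` of a `2`-form `β`, evaluated on `2k` vectors (which are
indexed by `Fin k × Fin 2`). -/
def wedgePow {P : Type*} (k : ℕ) (β : P → P → ℂ) (v : Fin k × Fin 2 → P) : ℂ :=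
  (1 / 2 : ℂ) ^ k * ∑ σ : Equiv.Perm (Fin k × Fin 2),
    ((Equiv.Perm.sign σ : ℤ) : ℂ) * ∏ i : Fin k, β (v (σ (i, 0))) (v (σ (i, 1)))

/-! ## Tropical manifolds -/

/-- The model space `ℝᵐ`. -/
abbrev Rn (m : ℕ) : Type := Fin m → ℝ

/-- A tropical manifold of dimension `m`: a smooth manifold whose given atlas (the tropical
structure) has transition functions in `ℝᵐ ⋊ GL(ℤᵐ)`. -/
class IsTropicalManifold (m : ℕ) (B : Type*) [TopologicalSpace B] [ChartedSpace (Rn m) B] : Prop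
    extends IsManifold 𝓘(ℝ, Rn m) ∞ B where
  transition : ∀ e ∈ atlas (Rn m) B, ∀ e' ∈ atlas (Rn m) B,
    ∃ (A : Matrix.GeneralLinearGroup (Fin m) ℤ) (b : Rn m), ∀ p ∈ e.source ∩ e'.source,
      e' p = ((A : Matrix (Fin m) (Fin m) ℤ).map (Int.cast : ℤ → ℝ)) *ᵥ (e p) + b

section Base

variable (m : ℕ) (B : Type*) [TopologicalSpace B] [ChartedSpace (Rn m) B]

/-- The tropical charts `(U_λ, ψ_λ)`; for `e` of this type, `e.1.source` is `U_λ`, and `e.1` is `ψ_λ`. -/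
abbrev TropChart : Type _ := atlas (Rn m) B

/-- The tangent space `T_p B`. -/
abbrev Tan (p : B) : Type := TangentSpace 𝓘(ℝ, Rn m) p

/-- The cotangent space `T*_p B`. -/
abbrev Cotan (p : B) : Type := Tan m B p →L[ℝ] ℝ

end Base

section Charts

variable {m : ℕ} {B : Type*} [TopologicalSpace B] [ChartedSpace (Rn m) B]

/-- The coordinates of a tangent vector at `p`: the coefficients of the `∂/∂x_i`. -/
def tanCoord (e : TropChart m B) (p : B) : Tan m B p →L[ℝ] Rn m :=
  mfderiv 𝓘(ℝ, Rn m) 𝓘(ℝ, Rn m) e.1 p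

/-- At the point with tropical coordinates `x`, the map `y ↦ ∑ y_i ∂/∂x_i`. -/
def tanVec (e : TropChart m B) (x : Rn m) : Rn m →L[ℝ] Tan m B (e.1.symm x) :=
  mfderiv 𝓘(ℝ, Rn m) 𝓘(ℝ, Rn m) e.1.symm x

/-- The covector `dx_i` at `p`. -/
def dx (e : TropChart m B) (p : B) (i : Fin m) : Cotan m B p :=
  (ContinuousLinearMap.proj (R := ℝ) (φ := fun _ : Fin m => ℝ) i).comp (tanCoord e p)

end Charts

/-! ## The torus bundles `X(B) = TB/Λ` and `W(B) = T*B/Λ*` -/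

section Torus

variable (m : ℕ) (B : Type*) [TopologicalSpace B] [ChartedSpace (Rn m) B]

/-- The lattice `Λ_p ⊆ T_p B` generated by the tropical coordinate vectors `∂/∂x_i`. -/
def lattice (p : B) : Submodule ℤ (Tan m B p) :=
  Submodule.span ℤ {v | ∃ e : TropChart m B, p ∈ e.1.source ∧
    ∃ i : Fin m, tanCoord e p v = Pi.single i 1}

/-- The dual lattice `Λ*_p ⊆ T*_p B` generated by the `dx_i`. -/
def dualLattice (p : B) : Submodule ℤ (Cotan m B p) :=
  Submodule.span ℤ {η | ∃ e : TropChart m B, p ∈ e.1.source ∧ ∃ i : Fin m, η = dx e p i}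

/-- `X(B) = TB/Λ`. -/
abbrev XB : Type _ := Σ p : B, Tan m B p ⧸ lattice m B p

/-- `W(B) = T*B/Λ*`. -/
abbrev WB : Type _ := Σ p : B, Cotan m B p ⧸ dualLattice m B p

end Torus

section Coordinates

variable {m : ℕ} {B : Type*} [TopologicalSpace B] [ChartedSpace (Rn m) B]

/-- The point `[∑ y_i ∂/∂x_i]` of `X(B)` over the point with coordinates `x`. On `ψ_λ(U_λ) × ℝᵐ` this
is a covering map onto the part of `X(B)` over `U_λ`, and its local inverses are the local coordinates
`(x, y)` of `X(B)`. -/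
def xPoint (e : TropChart m B) (z : Rn m × Rn m) : XB m B :=
  ⟨e.1.symm z.1, Submodule.Quotient.mk (tanVec e z.1 z.2)⟩

/-- The point `[∑ y_i dx_i]` of `W(B)` over the point with coordinates `x`. On `ψ_λ(U_λ) × ℝᵐ` this
is a covering map onto the part of `W(B)` over `U_λ`, and its local inverses are the local coordinates
`(x, ỹ)` of `W(B)`. -/
def wPoint (e : TropChart m B) (z : Rn m × Rn m) : WB m B :=
  ⟨e.1.symm z.1, Submodule.Quotient.mk (∑ i, z.2 i • dx e (e.1.symm z.1) i)⟩

/-- A subset of `X(B)` in the coordinates `(x, y)` over `U_λ`. -/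
def xRead (e : TropChart m B) (S : Set (XB m B)) : Set (Rn m × Rn m) :=
  {z | z.1 ∈ e.1.target ∧ xPoint e z ∈ S}

/-- A subset of `W(B)` in the coordinates `(x, ỹ)` over `U_λ`. -/
def wRead (e : TropChart m B) (S : Set (WB m B)) : Set (Rn m × Rn m) :=
  {z | z.1 ∈ e.1.target ∧ wPoint e z ∈ S}

/-- `S` is a real `d`-dimensional submanifold of `X(B)`. -/
def IsSubmanifoldX (d : ℕ) (S : Set (XB m B)) : Prop :=
  ∀ e : TropChart m B, IsSubmanifold d (xRead e S)

end Coordinates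

/-! ## Convex multi-valued functions and the mirror pair -/

/-- A convex multi-valued function `K = {K_λ}` on `B`. -/
structure ConvexMultivalued (m : ℕ) (B : Type*) [TopologicalSpace B] [ChartedSpace (Rn m) B] where
  /-- the functions `K_λ`; only their values on `U_λ` matter -/
  K : TropChart m B → B → ℝ
  smooth : ∀ e, ContDiffOn ℝ ∞ (fun x => K e (e.1.symm x)) e.1.target
  affine : ∀ e e' : TropChart m B, ∃ (a : Rn m) (c : ℝ), ∀ p ∈ e.1.source ∩ e'.1.source,
    K e p - K e' p = a ⬝ᵥ e.1 p + c
  convex : ∀ e : TropChart m B, ∀ x ∈ e.1.target,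
    (Matrix.of fun i j : Fin m => fderiv ℝ
      (fun x' => fderiv ℝ (fun x'' => K e (e.1.symm x'')) x' (Pi.single j 1)) x
      (Pi.single i 1)).PosDef

section Mirror

variable {m : ℕ} {B : Type*} [TopologicalSpace B] [ChartedSpace (Rn m) B]

/-- The Legendre transform `x̃_i = ∂K_λ/∂x_i`, at the point with coordinates `x`. -/
def legendre (K : ConvexMultivalued m B) (e : TropChart m B) (x : Rn m) : Rn m :=
  fun i => fderiv ℝ (fun x' => K.K e (e.1.symm x')) x (Pi.single i 1)

/-- The Hessian `∂²K_λ/∂x_i∂x_j`. -/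
def hess (K : ConvexMultivalued m B) (e : TropChart m B) (x : Rn m) : Matrix (Fin m) (Fin m) ℝ :=
  Matrix.of fun i j => fderiv ℝ (fun x' => legendre K e x' j) x (Pi.single i 1)

/-- The value of `dz_i = dx_i + √-1 dy_i` on a tangent vector of `X(B)`. -/
def dz (v : Rn m × Rn m) (i : Fin m) : ℂ := (v.1 i : ℂ) + Complex.I * (v.2 i : ℂ)

/-- The Kähler form `ω = (√-1/2) ∑ (∂²K_λ/∂x_i∂x_j) dz_i ∧ dz̄_j` on `X(B)`. -/
def omegaX (K : ConvexMultivalued m B) (e : TropChart m B) (z v w : Rn m × Rn m) : ℂ :=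
  (Complex.I / 2) * ∑ i, ∑ j, (hess K e z.1 i j : ℂ) *
    (dz v i * (starRingEnd ℂ) (dz w j) - dz w i * (starRingEnd ℂ) (dz v j))

/-- The holomorphic volume form `Ω = dz_1 ∧ ⋯ ∧ dz_m` on `X(B)`. -/
def OmegaX (v : Fin m → Rn m × Rn m) : ℂ :=
  Matrix.det (Matrix.of fun i j : Fin m => dz (v j) i)

/-- The symplectic (Kähler) form `ω̃ = ∑ dx_i ∧ dỹ_i` on `W(B)`. -/
def omegaW (v w : Rn m × Rn m) : ℝ := ∑ i, (v.1 i * w.2 i - w.1 i * v.2 i)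

/-- The holomorphic coordinates `z̃_i = x̃_i + √-1 ỹ_i` on `W(B)`. -/
def zW (K : ConvexMultivalued m B) (e : TropChart m B) (z : Rn m × Rn m) : Fin m → ℂ :=
  fun i => (legendre K e z.1 i : ℂ) + Complex.I * (z.2 i : ℂ)

/-! ### Lagrangian and special Lagrangian submanifolds of `X(B)` -/

/-- `L` is a Lagrangian submanifold of `(X(B), ω)`. -/
def IsLagrangian (K : ConvexMultivalued m B) (L : Set (XB m B)) : Prop :=
  IsSubmanifoldX m L ∧
  ∀ (e : TropChart m B) (O : Set (Rn m)) (φ : Rn m → Rn m × Rn m), IsLocalParam (xRead e L) O φ →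
    ∀ u ∈ O, ∀ a b : Rn m, omegaX K e (φ u) (fderiv ℝ φ u a) (fderiv ℝ φ u b) = 0

/-- `L` is a special Lagrangian submanifold of `(X(B), ω, Ω)` with phase `e^{√-1 θ}`. -/
def IsSpecialLagrangian (K : ConvexMultivalued m B) (θ : ℝ) (L : Set (XB m B)) : Prop :=
  IsLagrangian K L ∧
  ∀ (e : TropChart m B) (O : Set (Rn m)) (φ : Rn m → Rn m × Rn m), IsLocalParam (xRead e L) O φ →
    ∀ u ∈ O, ∀ a : Fin m → Rn m,
      (Complex.exp (-(Complex.I * (θ : ℂ))) * OmegaX (fun j => fderiv ℝ φ u (a j))).im = 0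

/-! ### Complex submanifolds of `W(B)` and connections over them -/

/-- A holomorphic local parametrization, by an open subset `O` of `ℂᵏ`, of a subset `C` of `W(B)`; it
is written in the coordinates `(x, ỹ)`. -/
def IsHolParam {k : ℕ} (K : ConvexMultivalued m B) (C : Set (WB m B)) (e : TropChart m B)
    (O : Set (Fin k → ℂ)) (φ : (Fin k → ℂ) → Rn m × Rn m) : Prop :=
  IsLocalParam (wRead e C) O φ ∧ DifferentiableOn ℂ (fun u => zW K e (φ u)) O

/-- `C` is a complex submanifold of `W(B)` of complex dimension `k`. -/
def IsComplexSubmanifold (K : ConvexMultivalued m B) (k : ℕ) (C : Set (WB m B)) : Prop :=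
  ∀ e : TropChart m B, ∀ p ∈ wRead e C, ∃ (O : Set (Fin k → ℂ)) (φ : (Fin k → ℂ) → Rn m × Rn m),
    IsHolParam K C e O φ ∧ p ∈ φ '' O

/-- The pull back of a `1`-form `A` (given in the coordinates `(x, ỹ)`) by `φ`. -/
def pullback {k : ℕ} (A : Rn m × Rn m → (Rn m × Rn m →L[ℝ] ℂ)) (φ : (Fin k → ℂ) → Rn m × Rn m)
    (u : Fin k → ℂ) : (Fin k → ℂ) →L[ℝ] ℂ :=
  (A (φ u)).comp (fderiv ℝ φ u)

/-- The connection `D = d + A` on the trivial line bundle over the `k`-dimensional complex submanifold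
`C` of `W(B)` is integrable: the `(0,2)`-part of its curvature vanishes. The `1`-form `A` along `C` is
given, for every tropical chart, in the coordinates `(x, ỹ)`. -/
def IsIntegrable (k : ℕ) (K : ConvexMultivalued m B) (C : Set (WB m B))
    (A : TropChart m B → Rn m × Rn m → (Rn m × Rn m →L[ℝ] ℂ)) : Prop :=
  ∀ (e : TropChart m B) (O : Set (Fin k → ℂ)) (φ : (Fin k → ℂ) → Rn m × Rn m),
    IsHolParam K C e O φ → ∀ u ∈ O, ∀ a b : Fin k → ℂ,
      part02 (curvature (pullback (A e) φ) u) a b = 0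

/-- The connection `D = d + A` on the trivial line bundle over the `k`-dimensional complex submanifold
`C` of `W(B)` with the Kähler form `ω̃|_C` is a deformed Hermitian Yang-Mills connection with phase
`e^{√-1 θ}`: `F^{(0,2)} = 0` and `Im (e^{-√-1 θ} (ω̃ + F)ᵏ) = 0`. -/
def IsDHYM (k : ℕ) (K : ConvexMultivalued m B) (θ : ℝ) (C : Set (WB m B))
    (A : TropChart m B → Rn m × Rn m → (Rn m × Rn m →L[ℝ] ℂ)) : Prop :=
  IsIntegrable k K C A ∧
  ∀ (e : TropChart m B) (O : Set (Fin k → ℂ)) (φ : (Fin k → ℂ) → Rn m × Rn m),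
    IsHolParam K C e O φ → ∀ u ∈ O, ∀ v : Fin k × Fin 2 → (Fin k → ℂ),
      (Complex.exp (-(Complex.I * (θ : ℂ))) * wedgePow k
        (fun a b => (omegaW (fderiv ℝ φ u a) (fderiv ℝ φ u b) : ℂ)
          + curvature (pullback (A e) φ) u a b) v).im = 0

/-! ## The bundle of rational affine subspaces -/

/-- `W` is a `k`-dimensional rational affine subspace of `ℝᵐ` (for `k ≤ m`): `W = ℝξ_1 + ⋯ + ℝξ_k + a`
for the first `k` members of an integral basis `ξ_1, …, ξ_k, ζ_{k+1}, …, ζ_m` of `ℤᵐ`. -/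
def IsRationalAffine (k : ℕ) (W : AffineSubspace ℝ (Rn m)) : Prop :=
  ∃ (ξ : Matrix (Fin m) (Fin m) ℤ) (a : Rn m), (ξ.det = 1 ∨ ξ.det = -1) ∧
    W = AffineSubspace.mk' a
      (Submodule.span ℝ {w | ∃ i : Fin m, (i : ℕ) < k ∧ w = fun j => ((ξ i j : ℤ) : ℝ)})

/-- The matrix `A(λ,μ)`, with `∂x_i^μ/∂x_j^λ` in row `j` and column `i`, at the point `p`. -/
def transA (e e' : TropChart m B) (p : B) : Matrix (Fin m) (Fin m) ℝ :=
  Matrix.of fun j i => fderiv ℝ (fun x => e'.1 (e.1.symm x)) (e.1 p) (Pi.single j 1) i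

/-- The vector `b(λ,μ)` with the components `∂(K_λ - K_μ)/∂x_j^λ`, at the point `p`. -/
def transB (K : ConvexMultivalued m B) (e e' : TropChart m B) (p : B) : Rn m :=
  fun j => fderiv ℝ (fun x => K.K e (e.1.symm x) - K.K e' (e.1.symm x)) (e.1 p) (Pi.single j 1)

/-- A section of the bundle `𝓕(k,m) → B` of `k`-dimensional rational affine subspaces, given by its
local expressions `V_λ : U_λ → F(k,m)`, which are related on overlaps by the transition functions of
the bundle: `V_λ = A(λ,μ) V_μ + b(λ,μ)`. -/
structure AffineSection (K : ConvexMultivalued m B) (k : ℕ) where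
  /-- the local expressions `V_λ`; only their values on `U_λ` matter -/
  loc : TropChart m B → B → AffineSubspace ℝ (Rn m)
  rational : ∀ e : TropChart m B, ∀ p ∈ e.1.source, IsRationalAffine k (loc e p)
  glue : ∀ e e' : TropChart m B, ∀ p ∈ e.1.source ∩ e'.1.source,
    (loc e p : Set (Rn m)) =
      (fun w => transA e e' p *ᵥ w + transB K e e' p) '' (loc e' p : Set (Rn m))

variable {K : ConvexMultivalued m B} {k : ℕ}

/-- The section is constant: every `V_λ` is a constant map. -/
def AffineSection.IsConstant (V : AffineSection K k) : Prop :=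
  ∀ e : TropChart m B, ∃ W : AffineSubspace ℝ (Rn m),
    IsRationalAffine k W ∧ ∀ p ∈ e.1.source, V.loc e p = W

/-- `U_λ(V) = {p ∈ U_λ | μ_λ(p) ∈ V_λ(p)}`, where `μ_λ = (x̃_1, …, x̃_m)`. -/
def AffineSection.localBase (V : AffineSection K k) (e : TropChart m B) : Set B :=
  {p | p ∈ e.1.source ∧ legendre K e (e.1 p) ∈ V.loc e p}

/-- `B(V) = ⋃ U_λ(V)`. -/
def AffineSection.base (V : AffineSection K k) : Set B := ⋃ e : TropChart m B, V.localBase e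

/-- The coefficients of the `∂/∂x_i` of `Y`, as functions of the tropical coordinates `x`. -/
def vecCoord (Y : ∀ p : B, Tan m B p) (e : TropChart m B) (x : Rn m) : Rn m :=
  tanCoord e (e.1.symm x) (Y (e.1.symm x))

/-- `Y` restricts to a smooth section of `ι*(TB)` over `B(V)`: its coefficients in every tropical chart
are smooth on `B(V)`. -/
def IsSmoothAlong (V : AffineSection K k) (Y : ∀ p : B, Tan m B p) : Prop :=
  ∀ e : TropChart m B,
    ContDiffOn ℝ ∞ (vecCoord Y e) {x | x ∈ e.1.target ∧ e.1.symm x ∈ V.base}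

/-! ## `L(V,Y)`, `C(V)` and `D^Y` -/

/-- `L(V,Y) ⊆ X(B)`: the union over `p ∈ B(V)` of the tori `T(V^⊥)_p + Y(p)`, where `T(V^⊥)_p` consists
of the classes of `∑ w_i ∂/∂x_i` with `w` in the annihilator of the linear part of `V_λ(p)`. -/
def lagrangian (V : AffineSection K k) (Y : ∀ p : B, Tan m B p) : Set (XB m B) :=
  {q | ∃ (e : TropChart m B) (x : Rn m) (w : Rn m), x ∈ e.1.target ∧
    e.1.symm x ∈ V.localBase e ∧ (∀ v ∈ (V.loc e (e.1.symm x)).direction, v ⬝ᵥ w = 0) ∧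
    q = ⟨e.1.symm x, Submodule.Quotient.mk (tanVec e x w + Y (e.1.symm x))⟩}

/-- `C(V) ⊆ W(B)`: the union over `p ∈ B(V)` of the tori `T(V)_p`, where `T(V)_p` consists of the
classes of `∑ w_i dx_i` with `w` in the linear part of `V_λ(p)`. -/
def complexSub (V : AffineSection K k) : Set (WB m B) :=
  {q | ∃ (e : TropChart m B) (p : B) (w : Rn m), p ∈ V.localBase e ∧
    w ∈ (V.loc e p).direction ∧ q = ⟨p, Submodule.Quotient.mk (∑ i, w i • dx e p i)⟩}

/-- The connection form `√-1 ∑ Y_j dỹ_j` of the Hermitian connection `D^Y = d + √-1 ∑ Y_j dỹ_j` on the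
trivial line bundle over `C(V)`; only its values over `B(V)` matter. -/
def connForm (Y : ∀ p : B, Tan m B p) (e : TropChart m B) (z : Rn m × Rn m) :
    Rn m × Rn m →L[ℝ] ℂ :=
  ∑ j, (Complex.I * (vecCoord Y e z.1 j : ℂ)) •
    (Complex.ofRealCLM.comp ((ContinuousLinearMap.proj (R := ℝ) (φ := fun _ : Fin m => ℝ) j).comp
      (ContinuousLinearMap.snd ℝ (Rn m) (Rn m))))

end Mirror

end

end TropicalMirror

open TropicalMirror

/-!
Near a point of `B(V)` choose a basis of `ℤ^m` whose first `k` members span `V̄`, and write `x̃` in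
this basis with respect to an origin on `V`. Together with fibre coordinates these functions
straighten `B(V)` and `C(V)` to coordinate subspaces and `L(V, Y)` to the graph of `Y` plus a
coordinate subspace, all up to integral translations.

Along `B(V)` let `G` and `N` be the restrictions to `V̄` of the inverse Hessian of `K` and of the
derivative `∂Y/∂x̃`. Both `ω|_L` and `F^{(0,2)}` vanish exactly when `N` is symmetric. Moreover
`Ω|_L` is `√-1^(m - k) det(G + √-1 N)` times a nonvanishing real form, and `(ω̃ + F)^k` is
`det(G + √-1 N)` times a nonvanishing real form, so that both phase conditions read
`Im (e^(-√-1 θ) det(G + √-1 N)) = 0` on `B(V)`.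
-/

namespace TropicalMirror

noncomputable section

open Filter Topology

/-! ### Local parametrizations -/

section LocalParam

variable {P E : Type*} [NormedAddCommGroup P] [NormedSpace ℝ P] [NormedAddCommGroup E]
  [NormedSpace ℝ E] {S U : Set E} {O : Set P} {φ : P → E} {r : E → P} {u : P}

theorem IsLocalParam.hasFDerivAt (hφ : IsLocalParam S O φ) (hu : u ∈ O) :
    HasFDerivAt φ (fderiv ℝ φ u) u :=
  ((hφ.smooth.contDiffAt (hφ.isOpen.mem_nhds hu)).differentiableAt (by simp)).hasFDerivAt

theorem IsLocalParam.eventually_mem (hφ : IsLocalParam S O φ) (hu : u ∈ O) :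
    ∀ᶠ v in 𝓝 u, φ v ∈ S :=
  (hφ.isOpen.eventually_mem hu).mono fun _ hv => hφ.mapsTo hv

theorem injective_of_hasFDerivAt_of_leftInverse {φ' : P →L[ℝ] E} {r' : E →L[ℝ] P}
    (hφ : HasFDerivAt φ φ' u) (hr : HasFDerivWithinAt r r' S (φ u))
    (hmem : ∀ᶠ v in 𝓝 u, φ v ∈ S) (hrφ : ∀ᶠ v in 𝓝 u, r (φ v) = v) :
    Function.Injective φ' := by
  have hid : HasFDerivAt (r ∘ φ) (ContinuousLinearMap.id ℝ P) u :=
    (hasFDerivAt_id u).congr_of_eventuallyEq hrφ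
  have hcomp : r' ∘L φ' = .id ℝ P := (hr.comp_hasFDerivAt u hφ hmem).unique hid
  exact Function.LeftInverse.injective (g := r') (DFunLike.congr_fun hcomp)

theorem IsLocalParam.of_leftInverse {S' : Set E} (hO : IsOpen O) (hU : IsOpen U)
    (hSU : S ∩ U = S') (hφ : ContDiffOn ℝ ∞ φ O) (hr : DifferentiableOn ℝ r S')
    (hmaps : Set.MapsTo φ O S') (hrφ : Set.LeftInvOn r φ O) (hφr : Set.LeftInvOn φ r S') :
    IsLocalParam S O φ where
  isOpen := hO
  smooth := hφ
  mapsTo := hmaps.mono_right (hSU ▸ Set.inter_subset_left)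
  injOn := hrφ.injOn
  immersion u hu :=
    injective_of_hasFDerivAt_of_leftInverse
      ((hφ.contDiffAt (hO.mem_nhds hu)).differentiableAt (by simp)).hasFDerivAt
      (hr _ (hmaps hu)).hasFDerivWithinAt
      ((hO.eventually_mem hu).mono hmaps) ((hO.eventually_mem hu).mono hrφ)
  isOpen_image O' hO'O hO' := by
    obtain ⟨W, hW, hpre⟩ := continuousOn_iff'.1 hr.continuousOn O' hO'
    have himage : φ '' O' = r ⁻¹' O' ∩ S' := by
      refine Set.Subset.antisymm ?_ fun p hp => ⟨r p, hp.1, hφr hp.2⟩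
      rintro _ ⟨u, hu, rfl⟩
      exact ⟨by rwa [Set.mem_preimage, hrφ (hO'O hu)], hmaps (hO'O hu)⟩
    refine ⟨U ∩ W, hU.inter hW, ?_⟩
    rw [himage, hpre, ← hSU, Set.inter_comm, Set.inter_assoc]

theorem IsLocalParam.of_affine_coordinates {W : Type*} [NormedAddCommGroup W] [NormedSpace ℝ W]
    [FiniteDimensional ℝ W] [FiniteDimensional ℝ P] {j : P →ₗ[ℝ] W} {c : W} {S' : Set E}
    {T : Set W} {f : E → W} {g : W → E} (hj : Function.Injective j) (hT : IsOpen T)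
    (hU : IsOpen U) (hSU : S ∩ U = S')
    (hg : ContDiffOn ℝ ∞ g {w | w ∈ T ∧ w - c ∈ LinearMap.range j}) (hf : DifferentiableOn ℝ f S')
    (hmaps_g : Set.MapsTo g {w | w ∈ T ∧ w - c ∈ LinearMap.range j} S')
    (hmaps_f : Set.MapsTo f S' {w | w ∈ T ∧ w - c ∈ LinearMap.range j})
    (hinv : Set.InvOn f g {w | w ∈ T ∧ w - c ∈ LinearMap.range j} S') :
    IsLocalParam S {u | j u + c ∈ T} (fun u => g (j u + c)) := by
  obtain ⟨ρ, hρ⟩ := j.exists_leftInverse_of_injective (LinearMap.ker_eq_bot.2 hj)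
  replace hρ : Function.LeftInverse ρ j := LinearMap.congr_fun hρ
  have hjc : ContDiff ℝ ∞ fun u => j u + c :=
    (LinearMap.toContinuousLinearMap j).contDiff.add contDiff_const
  have hmaps : Set.MapsTo (fun u => j u + c) {u | j u + c ∈ T}
      {w | w ∈ T ∧ w - c ∈ LinearMap.range j} := fun u hu => ⟨hu, by simp⟩
  refine .of_leftInverse (r := fun p => ρ (f p - c)) (hT.preimage hjc.continuous) hU hSU
    (hg.comp hjc.contDiffOn hmaps) ?_ (hmaps_g.comp hmaps) (fun u hu => ?_) fun p hp => ?_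
  · exact (LinearMap.toContinuousLinearMap ρ).differentiable.comp_differentiableOn
      (hf.sub_const c)
  · simp only [hinv.1 (hmaps hu), add_sub_cancel_right, hρ u]
  · obtain ⟨u, hu⟩ := (hmaps_f hp).2
    simp only [← hu, hρ u]
    rw [hu, sub_add_cancel, hinv.2 hp]

end LocalParam

/-! ### Straightening coordinates -/

theorem eq_of_abs_sub_lt_one_of_int {x y : ℝ} (hx : ∃ n : ℤ, x = n) (hy : ∃ n : ℤ, y = n)
    (h : |x - y| < 1) : x = y := by
  obtain ⟨a, rfl⟩ := hx
  obtain ⟨b, rfl⟩ := hy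
  have hab : a - b = 0 := Int.abs_lt_one_iff.1 (by exact_mod_cast h)
  rw [sub_eq_zero.1 hab]

theorem eventually_eq_of_continuousAt_of_int {X : Type*} [TopologicalSpace X] {f : X → ℝ} {x : X}
    (hf : ContinuousAt f x) (hint : ∀ᶠ y in 𝓝 x, ∃ n : ℤ, f y = n) : ∀ᶠ y in 𝓝 x, f y = f x := by
  filter_upwards [hint, hf.eventually (Metric.ball_mem_nhds _ one_pos)] with y hy hdist
  exact eq_of_abs_sub_lt_one_of_int hy hint.self_of_nhds hdist

theorem hasFDerivAt_apply_eq_zero_of_eventually_eq {P ι : Type*} [NormedAddCommGroup P]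
    [NormedSpace ℝ P] {f : P → ι → ℝ} {f' : P →L[ℝ] ι → ℝ} {u : P} {i : ι}
    (hf : HasFDerivAt f f' u) (hconst : ∀ᶠ v in 𝓝 u, f v i = f u i) (v : P) : f' v i = 0 :=
  DFunLike.congr_fun ((hasFDerivAt_pi'.1 hf i).unique
    ((hasFDerivAt_const (f u i) u).congr_of_eventuallyEq hconst)) v

theorem exists_isOpen_inter_eq_of_int {X κ : Type*} [TopologicalSpace X] [Finite κ] {S : Set X}
    {G : X → κ → ℝ} {t : Set κ} (hG : ContinuousOn G S)
    (hint : ∀ w ∈ S, ∀ i ∈ t, ∃ n : ℤ, G w i = n) {z : X} (hz : z ∈ S) :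
    ∃ U, IsOpen U ∧ S ∩ U = {w ∈ S | ∀ i ∈ t, G w i = G z i} := by
  obtain ⟨U, hU, hpre⟩ := continuousOn_iff'.1 hG (t.pi fun i => Metric.ball (G z i) 1)
    (isOpen_set_pi t.toFinite fun _ _ => Metric.isOpen_ball)
  refine ⟨U, hU, ?_⟩
  rw [Set.inter_comm, ← hpre]
  ext w
  refine ⟨fun hw => ⟨hw.2, fun i hi =>
    eq_of_abs_sub_lt_one_of_int (hint w hw.2 i hi) (hint z hz i hi) (hw.1 i hi)⟩,
    fun hw => ⟨fun i hi => ?_, hw.1⟩⟩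
  rw [hw.2 i hi]
  exact Metric.mem_ball_self one_pos

theorem exists_openPartialHomeomorph_of_hasFDerivAt_equiv {𝕜 E F : Type*} [RCLike 𝕜]
    [NormedAddCommGroup E] [NormedSpace 𝕜 E] [CompleteSpace E] [NormedAddCommGroup F]
    [NormedSpace 𝕜 F] {n : WithTop ℕ∞} (hn : n ≠ 0) {Ω : Set E} {f : E → F} (hΩ : IsOpen Ω)
    (hf : ContDiffOn 𝕜 n f Ω) (hf' : ∀ x ∈ Ω, ∃ A : E ≃L[𝕜] F, HasFDerivAt f (A : E →L[𝕜] F) x)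
    {x : E} (hx : x ∈ Ω) :
    ∃ h : OpenPartialHomeomorph E F, x ∈ h.source ∧ h.source ⊆ Ω ∧ ⇑h = f ∧
      ContDiffOn 𝕜 n h.symm h.target := by
  have hfat : ∀ y ∈ Ω, ContDiffAt 𝕜 n f y := fun y hy => hf.contDiffAt (hΩ.mem_nhds hy)
  obtain ⟨A, hA⟩ := hf' x hx
  let h := ((hfat x hx).toOpenPartialHomeomorph f hA hn).restrOpen Ω hΩ
  have hsource : h.source ⊆ Ω := Set.inter_subset_right
  refine ⟨h, ⟨(hfat x hx).mem_toOpenPartialHomeomorph_source hA hn, hx⟩, hsource, rfl,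
    fun y hy => ?_⟩
  have hy' := hsource (h.map_target hy)
  obtain ⟨A', hA'⟩ := hf' _ hy'
  exact (h.contDiffAt_symm hy hA' (hfat _ hy')).contDiffWithinAt

section Straightening

variable {E E' ι κ : Type*} [NormedAddCommGroup E'] [NormedSpace ℝ E']

/-- The common zero set in `Ω` of the components of `F` indexed by `s`; it describes `B(V)` in a
chart, `F` being the Legendre transform in coordinates adapted to `V`. -/
def zeroSlice (Ω : Set E) (F : E → ι → ℝ) (s : Set ι) : Set E :=
  {x | x ∈ Ω ∧ ∀ i ∈ s, F x i = 0}

/-- The coordinates on `E × E'` given by `F` on the base and by the linear coordinates `Ξ`, moved by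
the section `Y`, on the fibres. -/
def straighten (F : E → ι → ℝ) (Y : E → E') (Ξ : E' ≃L[ℝ] (κ → ℝ)) (z : E × E') :
    (ι → ℝ) × (κ → ℝ) :=
  (F z.1, Ξ (z.2 - Y z.1))

/-- The inverse of `straighten F Y Ξ`, for a local inverse `g` of `F`. -/
def unstraighten (g : (ι → ℝ) → E) (Y : E → E') (Ξ : E' ≃L[ℝ] (κ → ℝ))
    (w : (ι → ℝ) × (κ → ℝ)) : E × E' :=
  (g w.1, Y (g w.1) + Ξ.symm w.2)

/-- The points over a zero slice whose fibre coordinates indexed by `t` are integral; both `L(V,Y)`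
and `C(V)` are of this form in a chart. -/
def fiberedSet (Ω : Set E) (F : E → ι → ℝ) (Y : E → E') (Ξ : E' ≃L[ℝ] (κ → ℝ)) (s : Set ι)
    (t : Set κ) : Set (E × E') :=
  {z | z.1 ∈ zeroSlice Ω F s ∧ ∀ i ∈ t, ∃ n : ℤ, (straighten F Y Ξ z).2 i = n}

/-- The part of a fibered set over `Ω` on which the fibre coordinates indexed by `t` are those of
`n`. -/
def sheet (Ω : Set E) (F : E → ι → ℝ) (Y : E → E') (Ξ : E' ≃L[ℝ] (κ → ℝ)) (s : Set ι)
    (t : Set κ) (n : κ → ℝ) : Set (E × E') :=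
  {z | z.1 ∈ zeroSlice Ω F s ∧ ∀ i ∈ t, (straighten F Y Ξ z).2 i = n i}

/-- The tangent space of a fibered set in straightening coordinates. -/
def coordSubspace (s : Set ι) (t : Set κ) : Submodule ℝ ((ι → ℝ) × (κ → ℝ)) :=
  (Submodule.pi s fun _ => ⊥).prod (Submodule.pi t fun _ => ⊥)

theorem mem_coordSubspace {s : Set ι} {t : Set κ} {w : (ι → ℝ) × (κ → ℝ)} :
    w ∈ coordSubspace s t ↔ (∀ i ∈ s, w.1 i = 0) ∧ ∀ i ∈ t, w.2 i = 0 := by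
  simp [coordSubspace, Submodule.mem_prod, Submodule.mem_pi]

variable {Ω : Set E} {F : E → ι → ℝ} {g : (ι → ℝ) → E} {Y : E → E'} {Ξ : E' ≃L[ℝ] (κ → ℝ)}
  {s : Set ι} {t : Set κ}

theorem straighten_unstraighten {w : (ι → ℝ) × (κ → ℝ)} (h : F (g w.1) = w.1) :
    straighten F Y Ξ (unstraighten g Y Ξ w) = w := by
  simp [straighten, unstraighten, h]

theorem unstraighten_straighten {z : E × E'} (h : g (F z.1) = z.1) :
    unstraighten g Y Ξ (straighten F Y Ξ z) = z := by
  simp [straighten, unstraighten, h]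

theorem straighten_injective (hF : Function.Injective F) :
    Function.Injective (straighten F Y Ξ) := fun z w h => by
  have hfst : z.1 = w.1 := hF (congrArg Prod.fst h)
  have hsnd : z.2 - Y z.1 = w.2 - Y w.1 := Ξ.injective (congrArg Prod.snd h)
  exact Prod.ext hfst (by rwa [hfst, sub_left_inj] at hsnd)

theorem mapsTo_fst_fiberedSet :
    Set.MapsTo Prod.fst (fiberedSet Ω F Y Ξ s t) (zeroSlice Ω F s) :=
  fun _ hz => hz.1

theorem sub_mem_coordSubspace {n : κ → ℝ} {w : (ι → ℝ) × (κ → ℝ)} :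
    w - (0, n) ∈ coordSubspace s t ↔ (∀ i ∈ s, w.1 i = 0) ∧ ∀ i ∈ t, w.2 i = n i := by
  simp [mem_coordSubspace, sub_eq_zero]

section Sheet

variable [TopologicalSpace E] (h : OpenPartialHomeomorph E (ι → ℝ)) {n : κ → ℝ}

theorem invOn_straighten_unstraighten :
    Set.InvOn (straighten h Y Ξ) (unstraighten h.symm Y Ξ)
      {w | w ∈ Prod.fst ⁻¹' h.target ∧ w - (0, n) ∈ coordSubspace s t}
      (sheet h.source h Y Ξ s t n) :=
  ⟨fun _ hw => straighten_unstraighten (h.right_inv hw.1),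
    fun _ hz => unstraighten_straighten (h.left_inv hz.1.1)⟩

theorem mapsTo_straighten_sheet :
    Set.MapsTo (straighten h Y Ξ) (sheet h.source h Y Ξ s t n)
      {w | w ∈ Prod.fst ⁻¹' h.target ∧ w - (0, n) ∈ coordSubspace s t} :=
  fun _ hz => ⟨h.map_source hz.1.1, sub_mem_coordSubspace.2 ⟨hz.1.2, hz.2⟩⟩

theorem mapsTo_unstraighten_sheet :
    Set.MapsTo (unstraighten h.symm Y Ξ)
      {w | w ∈ Prod.fst ⁻¹' h.target ∧ w - (0, n) ∈ coordSubspace s t}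
      (sheet h.source h Y Ξ s t n) := fun w hw => by
  have hw' := sub_mem_coordSubspace.1 hw.2
  refine ⟨⟨h.map_target hw.1, ?_⟩, ?_⟩
  · simpa only [unstraighten, h.right_inv hw.1] using hw'.1
  · simpa only [straighten_unstraighten (h.right_inv hw.1)] using hw'.2

end Sheet

variable [NormedAddCommGroup E] [NormedSpace ℝ E]

/-- The derivative of `straighten F Y Ξ` at a point where `F` and `Y` have the derivatives `F'` and
`Y'`. -/
def straightenCLM (F' : E →L[ℝ] ι → ℝ) (Y' : E →L[ℝ] E') (Ξ : E' ≃L[ℝ] (κ → ℝ)) :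
    E × E' →L[ℝ] (ι → ℝ) × (κ → ℝ) :=
  (F' ∘L .fst ℝ E E').prod ((Ξ : E' →L[ℝ] κ → ℝ) ∘L (.snd ℝ E E' - Y' ∘L .fst ℝ E E'))

variable {P : Type*} [NormedAddCommGroup P] [NormedSpace ℝ P]
  {j : P →ₗ[ℝ] (ι → ℝ) × (κ → ℝ)}

section Tangent

variable {O : Set P} {φ : P → E × E'} {u : P} {F' : E →L[ℝ] ι → ℝ} {Y' : E →L[ℝ] E'}
  [Finite ι] [Finite κ]

theorem IsLocalParam.hasFDerivAt_straighten (hφ : IsLocalParam (fiberedSet Ω F Y Ξ s t) O φ)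
    (hu : u ∈ O) (hF : HasFDerivAt F F' (φ u).1)
    (hY : HasFDerivWithinAt Y Y' (zeroSlice Ω F s) (φ u).1) :
    HasFDerivAt (fun v => straighten F Y Ξ (φ v)) (straightenCLM F' Y' Ξ ∘L fderiv ℝ φ u) u := by
  cases nonempty_fintype ι
  cases nonempty_fintype κ
  have hφ' := hφ.hasFDerivAt hu
  exact (hF.comp u hφ'.fst).prodMk (Ξ.hasFDerivAt.comp u (hφ'.snd.sub (hY.comp_hasFDerivAt u hφ'.fst
    ((hφ.eventually_mem hu).mono fun _ hv => hv.1))))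

theorem IsLocalParam.straighten_fderiv_mem (hφ : IsLocalParam (fiberedSet Ω F Y Ξ s t) O φ)
    (hu : u ∈ O) (hF : HasFDerivAt F F' (φ u).1)
    (hY : HasFDerivWithinAt Y Y' (zeroSlice Ω F s) (φ u).1) (v : P) :
    straighten F' Y' Ξ (fderiv ℝ φ u v) ∈ coordSubspace s t := by
  cases nonempty_fintype ι
  cases nonempty_fintype κ
  have hstr := hφ.hasFDerivAt_straighten hu hF hY
  refine mem_coordSubspace.2 ⟨fun i hi => ?_, fun i hi => ?_⟩
  · refine hasFDerivAt_apply_eq_zero_of_eventually_eq hstr.fst ?_ v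
    filter_upwards [hφ.eventually_mem hu] with w hw
    exact (hw.1.2 i hi).trans ((hφ.mapsTo hu).1.2 i hi).symm
  · exact hasFDerivAt_apply_eq_zero_of_eventually_eq hstr.snd (eventually_eq_of_continuousAt_of_int
      (continuousAt_pi.1 hstr.continuousAt.snd i)
      ((hφ.eventually_mem hu).mono fun w hw => hw.2 i hi)) v

theorem IsLocalParam.exists_linearEquiv_straighten_fderiv [FiniteDimensional ℝ P]
    (hj : Function.Injective j) (hrange : LinearMap.range j = coordSubspace s t)
    (hφ : IsLocalParam (fiberedSet Ω F Y Ξ s t) O φ) (hu : u ∈ O) (hF : HasFDerivAt F F' (φ u).1)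
    (hF' : Function.Injective F') (hY : HasFDerivWithinAt Y Y' (zeroSlice Ω F s) (φ u).1) :
    ∃ M : P ≃ₗ[ℝ] P, ∀ v, straighten F' Y' Ξ (fderiv ℝ φ u v) = j (M v) := by
  let D : P →ₗ[ℝ] LinearMap.range j :=
    (straightenCLM F' Y' Ξ ∘L fderiv ℝ φ u : P →ₗ[ℝ] _).codRestrict _ fun v =>
      hrange ▸ hφ.straighten_fderiv_mem hu hF hY v
  have hD : Function.Injective D := fun v w h =>
    hφ.immersion u hu (straighten_injective hF' (congrArg Subtype.val h))
  let e := LinearEquiv.ofInjective j hj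
  refine ⟨LinearEquiv.ofInjectiveEndo (e.symm.toLinearMap ∘ₗ D) (e.symm.injective.comp hD),
    fun v => ?_⟩
  exact (congrArg Subtype.val (e.apply_symm_apply (D v))).symm

end Tangent

variable [Fintype ι]

theorem contDiffOn_unstraighten_sheet [Fintype κ] {n : κ → ℝ} (h : OpenPartialHomeomorph E (ι → ℝ))
    (hh : ContDiffOn ℝ ∞ h.symm h.target)
    (hY : ContDiffOn ℝ ∞ Y (zeroSlice h.source h s)) :
    ContDiffOn ℝ ∞ (unstraighten h.symm Y Ξ)
      {w | w ∈ Prod.fst ⁻¹' h.target ∧ w - (0, n) ∈ coordSubspace s t} := by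
  have hsymm : ContDiffOn ℝ ∞ (fun w : (ι → ℝ) × (κ → ℝ) => h.symm w.1)
      {w | w ∈ Prod.fst ⁻¹' h.target ∧ w - (0, n) ∈ coordSubspace s t} :=
    hh.comp contDiffOn_fst fun _ hw => hw.1
  exact hsymm.prodMk ((hY.comp hsymm fun w hw =>
    (mapsTo_unstraighten_sheet (Y := Y) (Ξ := Ξ) h hw).1).add
    (Ξ.symm.contDiff.comp_contDiffOn contDiffOn_snd))

theorem contDiffOn_straighten [Fintype κ] (hF : ContDiffOn ℝ ∞ F Ω)
    (hY : ContDiffOn ℝ ∞ Y (zeroSlice Ω F s)) :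
    ContDiffOn ℝ ∞ (straighten F Y Ξ) (fiberedSet Ω F Y Ξ s t) :=
  (hF.comp contDiffOn_fst fun _ hz => hz.1.1).prodMk (Ξ.contDiff.comp_contDiffOn
    (contDiffOn_snd.sub (hY.comp contDiffOn_fst mapsTo_fst_fiberedSet)))

theorem exists_isOpen_inter_eq_sheet [Finite κ] (hF : ContDiffOn ℝ ∞ F Ω)
    (hY : ContDiffOn ℝ ∞ Y (zeroSlice Ω F s)) {Ω' : Set E} (hΩ' : IsOpen Ω') (hΩ'Ω : Ω' ⊆ Ω)
    {z : E × E'} (hz : z ∈ fiberedSet Ω F Y Ξ s t) :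
    ∃ U, IsOpen U ∧
      fiberedSet Ω F Y Ξ s t ∩ U = sheet Ω' F Y Ξ s t (straighten F Y Ξ z).2 := by
  cases nonempty_fintype κ
  obtain ⟨U, hU, hSU⟩ := exists_isOpen_inter_eq_of_int
    (contDiffOn_straighten hF hY).continuousOn.snd (fun w hw => hw.2) hz
  refine ⟨U ∩ Prod.fst ⁻¹' Ω', hU.inter (hΩ'.preimage continuous_fst), ?_⟩
  rw [← Set.inter_assoc, hSU]
  ext w
  constructor
  · rintro ⟨⟨hw, hwt⟩, hwΩ'⟩
    exact ⟨⟨hwΩ', hw.1.2⟩, hwt⟩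
  · rintro ⟨⟨hwΩ', hws⟩, hwt⟩
    exact ⟨⟨⟨⟨hΩ'Ω hwΩ', hws⟩, fun i hi => hwt i hi ▸ hz.2 i hi⟩, hwt⟩, hwΩ'⟩

theorem exists_isLocalParam_fiberedSet [Finite κ] [CompleteSpace E] [FiniteDimensional ℝ P]
    (hj : Function.Injective j) (hrange : LinearMap.range j = coordSubspace s t)
    (hΩ : IsOpen Ω) (hF : ContDiffOn ℝ ∞ F Ω)
    (hF' : ∀ x ∈ Ω, ∃ A : E ≃L[ℝ] (ι → ℝ), HasFDerivAt F (A : E →L[ℝ] (ι → ℝ)) x)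
    (hY : ContDiffOn ℝ ∞ Y (zeroSlice Ω F s)) {z : E × E'} (hz : z ∈ fiberedSet Ω F Y Ξ s t) :
    ∃ (O : Set P) (φ : P → E × E') (n : κ → ℝ), IsLocalParam (fiberedSet Ω F Y Ξ s t) O φ ∧
      z ∈ φ '' O ∧ ∀ u ∈ O, straighten F Y Ξ (φ u) = j u + (0, n) := by
  cases nonempty_fintype κ
  obtain ⟨h, hzh, hhΩ, rfl, hsymm⟩ :=
    exists_openPartialHomeomorph_of_hasFDerivAt_equiv (by simp) hΩ hF hF' hz.1.1
  obtain ⟨U, hU, hSU⟩ := exists_isOpen_inter_eq_sheet hF hY h.open_source hhΩ hz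
  set n := (straighten h Y Ξ z).2
  have hsheet : sheet h.source h Y Ξ s t n ⊆ fiberedSet Ω h Y Ξ s t :=
    hSU ▸ Set.inter_subset_left
  have hparam : IsLocalParam (fiberedSet Ω h Y Ξ s t) {u | j u + (0, n) ∈ Prod.fst ⁻¹' h.target}
      fun u => unstraighten h.symm Y Ξ (j u + (0, n)) := by
    refine .of_affine_coordinates hj (h.open_target.preimage continuous_fst) hU hSU
      (f := straighten h Y Ξ) ?_
      (((contDiffOn_straighten hF hY).mono hsheet).differentiableOn (by simp)) ?_ ?_ ?_ <;>
      rw [hrange]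
    · exact contDiffOn_unstraighten_sheet h hsymm (hY.mono fun x hx => ⟨hhΩ hx.1, hx.2⟩)
    · exact mapsTo_unstraighten_sheet h
    · exact mapsTo_straighten_sheet h
    · exact invOn_straighten_unstraighten h
  have hz_sheet : z ∈ sheet h.source h Y Ξ s t n := ⟨⟨hzh, hz.1.2⟩, fun _ _ => rfl⟩
  obtain ⟨hz_target, u, hu⟩ := hrange ▸ mapsTo_straighten_sheet h hz_sheet
  refine ⟨_, _, n, hparam, ⟨u, ?_, ?_⟩, fun u hu => straighten_unstraighten (h.right_inv hu)⟩
  · rwa [Set.mem_ofPred_eq, hu, sub_add_cancel]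
  · simp only [hu, sub_add_cancel]
    exact unstraighten_straighten (h.left_inv hzh)

end Straightening

/-! ### Wedge powers of two-forms -/

section WedgePow

theorem exists_eq_prodCongrLeft_mul_prodCongrRight {ι κ : Type*} [Finite ι] [Finite κ]
    {σ : Equiv.Perm (ι × κ)} {g : ι → ι} (hg : ∀ i c, (σ (i, c)).1 = g i) (c₀ : κ) :
    ∃ (π : Equiv.Perm ι) (τ : ι → Equiv.Perm κ),
      σ = Equiv.prodCongrLeft (fun _ : κ => π) * Equiv.prodCongrRight τ := by
  have hgsurj : Function.Surjective g := fun a =>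
    ⟨(σ.symm (a, c₀)).1, by rw [← hg _ (σ.symm (a, c₀)).2, Prod.mk.eta, σ.apply_symm_apply]⟩
  have hinj : ∀ i, Function.Injective fun c => (σ (i, c)).2 := fun i c d h =>
    (Prod.mk.inj (σ.injective (Prod.ext ((hg i c).trans (hg i d).symm) h))).2
  refine ⟨.ofBijective g (Finite.surjective_iff_bijective.1 hgsurj),
    fun i => .ofBijective _ (Finite.injective_iff_bijective.1 (hinj i)), ?_⟩
  ext1 ⟨i, c⟩
  exact Prod.ext (hg i c) rfl

variable {ι : Type*} [Fintype ι]

section PairForm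

variable {R : Type*} [CommRing R]

/-- The form `∑ Z_ij dp_i ∧ dq_j` on the space of the `(p, q)`, where `p i = u (i, 0)` and
`q j = u (j, 1)`. -/
def pairForm (Z : Matrix ι ι R) : (ι × Fin 2 → R) →ₗ[R] (ι × Fin 2 → R) →ₗ[R] R :=
  let p := LinearMap.funLeft R R fun i : ι => (i, (0 : Fin 2))
  let q := LinearMap.funLeft R R fun i : ι => (i, (1 : Fin 2))
  LinearMap.mk₂ R (fun u w => p u ⬝ᵥ Z *ᵥ q w - p w ⬝ᵥ Z *ᵥ q u)
    (fun u u' w => by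
      simp only [map_add, add_dotProduct, Matrix.mulVec_add, dotProduct_add]
      abel)
    (fun c u w => by
      simp only [map_smul, smul_dotProduct, Matrix.mulVec_smul, dotProduct_smul, smul_sub])
    (fun u w w' => by
      simp only [map_add, add_dotProduct, Matrix.mulVec_add, dotProduct_add]
      abel)
    (fun c u w => by
      simp only [map_smul, smul_dotProduct, Matrix.mulVec_smul, dotProduct_smul, smul_sub])

theorem pairForm_apply (Z : Matrix ι ι R) (u w : ι × Fin 2 → R) :
    pairForm Z u w = (fun i => u (i, 0)) ⬝ᵥ Z *ᵥ (fun i => w (i, 1)) -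
      (fun i => w (i, 0)) ⬝ᵥ Z *ᵥ fun i => u (i, 1) :=
  rfl

end PairForm

variable [DecidableEq ι]

/-- The values of the standard symplectic form `∑ dp_i ∧ dq_i` on the standard basis, which is
indexed by `ι × Fin 2`. -/
def stdPairing (s t : ι × Fin 2) : ℤ :=
  if s.1 = t.1 then (t.2 : ℤ) - (s.2 : ℤ) else 0

theorem sign_mul_prod_stdPairing (π : Equiv.Perm ι) (τ : ι → Equiv.Perm (Fin 2)) :
    (Equiv.Perm.sign (Equiv.prodCongrLeft (fun _ : Fin 2 => π) * Equiv.prodCongrRight τ) : ℤ) *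
      ∏ i, stdPairing (π i, τ i 0) (π i, τ i 1) = 1 := by
  have hpairing : ∀ i, stdPairing (π i, τ i 0) (π i, τ i 1) = Equiv.Perm.sign (τ i) := fun i => by
    have hsign : ∀ ρ : Equiv.Perm (Fin 2), (ρ 1 : ℤ) - (ρ 0 : ℤ) = Equiv.Perm.sign ρ := by decide
    simp only [stdPairing, if_true, hsign]
  rw [Finset.prod_congr rfl fun i _ => hpairing i, map_mul, Equiv.Perm.sign_prodCongrLeft,
    Equiv.Perm.sign_prodCongrRight, Fin.prod_univ_two, Int.units_mul_self, one_mul,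
    ← Units.coe_prod, ← Units.val_mul, Int.units_mul_self, Units.val_one]

theorem sum_sign_mul_prod_stdPairing :
    ∑ σ : Equiv.Perm (ι × Fin 2), (Equiv.Perm.sign σ : ℤ) *
      ∏ i, stdPairing (σ (i, 0)) (σ (i, 1)) =
      2 ^ Fintype.card ι * (Fintype.card ι).factorial := by
  let f : Equiv.Perm ι × (ι → Equiv.Perm (Fin 2)) → Equiv.Perm (ι × Fin 2) := fun p =>
    Equiv.prodCongrLeft (fun _ : Fin 2 => p.1) * Equiv.prodCongrRight p.2
  have hf : Function.Injective f := fun p q h => by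
    have hval : ∀ i c, (p.1 i, p.2 i c) = (q.1 i, q.2 i c) := fun i c =>
      DFunLike.congr_fun h (i, c)
    exact Prod.ext (Equiv.ext fun i => (Prod.mk.inj (hval i 0)).1)
      (funext fun i => Equiv.ext fun c => (Prod.mk.inj (hval i c)).2)
  have hzero : ∀ σ, σ ∉ Set.range f → (Equiv.Perm.sign σ : ℤ) *
      ∏ i, stdPairing (σ (i, 0)) (σ (i, 1)) = 0 := fun σ hσ => by
    by_contra hne
    have hfst : ∀ i, (σ (i, 0)).1 = (σ (i, 1)).1 := fun i => by
      by_contra hi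
      exact hne (by rw [Finset.prod_eq_zero (Finset.mem_univ i) (if_neg hi), mul_zero])
    obtain ⟨π, τ, h⟩ := exists_eq_prodCongrLeft_mul_prodCongrRight (σ := σ)
      (g := fun i => (σ (i, 0)).1) (fun i => Fin.forall_fin_two.2 ⟨rfl, (hfst i).symm⟩) 0
    exact hσ ⟨(π, τ), h.symm⟩
  rw [← Finset.sum_of_injOn (s := Finset.univ) f hf.injOn (by simp) (fun σ _ hσ =>
    hzero σ (by simpa using hσ)) fun p _ => (sign_mul_prod_stdPairing p.1 p.2).symm]
  simp [Fintype.card_perm, mul_comm]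

theorem prod_update_pair {R E : Type*} [CommMonoid R] (β : E → E → R)
    (v : ι × Fin 2 → E) (s : ι × Fin 2) (x : E) :
    ∏ i, β (Function.update v s x (i, 0)) (Function.update v s x (i, 1)) =
      β (Function.update v s x (s.1, 0)) (Function.update v s x (s.1, 1)) *
        ∏ i ∈ Finset.univ.erase s.1, β (v (i, 0)) (v (i, 1)) := by
  rw [← Finset.mul_prod_erase _ _ (Finset.mem_univ s.1)]
  congr 1
  refine Finset.prod_congr rfl fun i hi => ?_
  have hne : ∀ c, (i, c) ≠ s := fun c h => (Finset.mem_erase.1 hi).1 (congrArg Prod.fst h)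
  rw [Function.update_of_ne (hne 0), Function.update_of_ne (hne 1)]

variable {R E : Type*} [CommRing R] [AddCommGroup E] [Module R E]

/-- The multilinear map `v ↦ ∏ β (v (i, 0)) (v (i, 1))`; its alternatization is a multiple of the
wedge power of `β`. -/
def prodPairs (β : E →ₗ[R] E →ₗ[R] R) : MultilinearMap R (fun _ : ι × Fin 2 => E) R :=
  MultilinearMap.mk' (fun v => ∏ i, β (v (i, 0)) (v (i, 1)))
    (fun v s x y => by
      simp only [prod_update_pair (fun a b => β a b) v s, ← add_mul]
      obtain ⟨i, c⟩ := s
      fin_cases c <;> simp [Function.update])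
    (fun v s a x => by
      simp only [prod_update_pair (fun a b => β a b) v s, smul_eq_mul, ← mul_assoc]
      obtain ⟨i, c⟩ := s
      fin_cases c <;> simp [Function.update])

theorem prodPairs_apply (β : E →ₗ[R] E →ₗ[R] R) (v : ι × Fin 2 → E) :
    prodPairs β v = ∏ i, β (v (i, 0)) (v (i, 1)) :=
  rfl

theorem pairForm_one_single (s t : ι × Fin 2) :
    pairForm (1 : Matrix ι ι R) (Pi.single s 1) (Pi.single t 1) = stdPairing s t := by
  obtain ⟨i, a⟩ := s
  obtain ⟨j, b⟩ := t
  rw [pairForm_apply]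
  simp only [Matrix.one_mulVec, dotProduct, Pi.single_apply, Prod.mk.injEq]
  rcases eq_or_ne i j with rfl | h <;> fin_cases a <;> fin_cases b <;>
    simp_all [stdPairing, eq_comm]

theorem pairForm_eq_pairForm_one (Z : Matrix ι ι R) (u w : ι × Fin 2 → R) :
    pairForm Z u w = pairForm 1 (Matrix.blockDiagonal ![Zᵀ, 1] *ᵥ u)
      (Matrix.blockDiagonal ![Zᵀ, 1] *ᵥ w) := by
  have hblock : ∀ (v : ι × Fin 2 → R) i c, (Matrix.blockDiagonal ![Zᵀ, 1] *ᵥ v) (i, c) =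
      ((![Zᵀ, 1] : Fin 2 → Matrix ι ι R) c *ᵥ fun j => v (j, c)) i := fun v i c => by
    simp [Matrix.mulVec, dotProduct, Fintype.sum_prod_type, Matrix.blockDiagonal_apply]
  simp only [pairForm_apply, hblock, Matrix.dotProduct_mulVec, Matrix.cons_val_zero,
    Matrix.cons_val_one, Matrix.mulVec_transpose, Matrix.one_mulVec]

theorem alternatization_prodPairs_pairForm_one (v : ι × Fin 2 → ι × Fin 2 → R) :
    (prodPairs (pairForm 1)).alternatization v =
      2 ^ Fintype.card ι * (Fintype.card ι).factorial * (Matrix.of v).det := by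
  have hstd : (prodPairs (pairForm (1 : Matrix ι ι R))).alternatization
      (Pi.basisFun R (ι × Fin 2)) = 2 ^ Fintype.card ι * (Fintype.card ι).factorial := by
    have hsum := congrArg (Int.cast : ℤ → R) (sum_sign_mul_prod_stdPairing (ι := ι))
    push_cast at hsum
    rw [← hsum, MultilinearMap.alternatization_apply]
    refine Finset.sum_congr rfl fun σ _ => ?_
    simp [prodPairs_apply, pairForm_one_single, Units.smul_def, zsmul_eq_mul]
  rw [AlternatingMap.eq_smul_basis_det (Pi.basisFun R (ι × Fin 2))
    (prodPairs (pairForm 1)).alternatization, AlternatingMap.smul_apply, hstd, Pi.basisFun_det]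
  rfl

theorem alternatization_prodPairs_pairForm (Z : Matrix ι ι R) (v : ι × Fin 2 → ι × Fin 2 → R) :
    (prodPairs (pairForm Z)).alternatization v =
      2 ^ Fintype.card ι * (Fintype.card ι).factorial * (Z.det * (Matrix.of v).det) := by
  have hbase : (prodPairs (pairForm Z)).alternatization v =
      (prodPairs (pairForm 1)).alternatization fun s => Matrix.blockDiagonal ![Zᵀ, 1] *ᵥ v s := by
    simp only [MultilinearMap.alternatization_apply, MultilinearMap.domDomCongr_apply,
      prodPairs_apply, pairForm_eq_pairForm_one Z]
  have hmul : (Matrix.of fun s => Matrix.blockDiagonal ![Zᵀ, 1] *ᵥ v s) =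
      Matrix.of v * (Matrix.blockDiagonal ![Zᵀ, 1])ᵀ := by
    ext s t
    exact dotProduct_comm _ _
  rw [hbase, alternatization_prodPairs_pairForm_one, hmul, Matrix.det_mul, Matrix.det_transpose,
    Matrix.det_blockDiagonal]
  simp [mul_comm]

theorem wedgePow_eq_alternatization {E : Type*} [AddCommGroup E] [Module ℂ E] (k : ℕ)
    (β : E →ₗ[ℂ] E →ₗ[ℂ] ℂ) (v : Fin k × Fin 2 → E) :
    wedgePow k (fun a b => β a b) v = (1 / 2) ^ k * (prodPairs β).alternatization v := by
  simp [wedgePow, MultilinearMap.alternatization_apply, prodPairs_apply, Units.smul_def,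
    zsmul_eq_mul]

theorem wedgePow_pairForm {k : ℕ} (Z : Matrix (Fin k) (Fin k) ℂ)
    (v : Fin k × Fin 2 → Fin k × Fin 2 → ℂ) :
    wedgePow k (fun a b => pairForm Z a b) v = k.factorial * (Z.det * (Matrix.of v).det) := by
  have hpow : (1 / 2 : ℂ) ^ k * 2 ^ k = 1 := by
    rw [← mul_pow, one_div, inv_mul_cancel₀ two_ne_zero, one_pow]
  rw [wedgePow_eq_alternatization, alternatization_prodPairs_pairForm, Fintype.card_fin]
  linear_combination (k.factorial * (Z.det * (Matrix.of v).det)) * hpow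

end WedgePow

/-! ### Integral coordinates -/

section IntegralCoordinates

variable {ι κ R : Type*} [Fintype ι]

theorem mem_span_image_row_iff [CommRing R] [DecidableEq ι] {X Z : Matrix ι ι R} (h : X * Z = 1)
    {s : Set ι} {d : ι → R} :
    d ∈ Submodule.span R (X.row '' s) ↔ ∀ i ∉ s, (d ᵥ* Z) i = 0 := by
  constructor
  · have hle : Submodule.span R (X.row '' s) ≤
        (Submodule.pi sᶜ fun _ => ⊥).comap (Matrix.vecMulLinear Z) := by
      rw [Submodule.span_le]
      rintro _ ⟨l, hl, rfl⟩ i hi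
      have hne : l ≠ i := fun hli => hi (hli ▸ hl)
      exact (congrFun (congrFun h l) i).trans (Matrix.one_apply_ne hne)
    exact fun hd i hi => hle hd i hi
  · intro hd
    have hsum : d = ∑ i, (d ᵥ* Z) i • X.row i := by
      have hdZX := Matrix.vecMul_eq_sum (d ᵥ* Z) X
      rwa [Matrix.vecMul_vecMul, mul_eq_one_comm.1 h, Matrix.vecMul_one] at hdZX
    rw [hsum]
    refine Submodule.sum_mem _ fun i _ => ?_
    by_cases hi : i ∈ s
    · exact Submodule.smul_mem _ _ (Submodule.subset_span (Set.mem_image_of_mem _ hi))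
    · rw [hd i hi, zero_smul]
      exact Submodule.zero_mem _

theorem forall_mem_span_image_row_dotProduct_eq_zero_iff [CommRing R] {X : Matrix κ ι R} {s : Set κ}
    {w : ι → R} :
    (∀ d ∈ Submodule.span R (X.row '' s), d ⬝ᵥ w = 0) ↔ ∀ i ∈ s, (X *ᵥ w) i = 0 := by
  have hle := Submodule.span_le (s := X.row '' s) (p := ((dotProductBilin R R).flip w).ker)
  exact hle.trans Set.forall_mem_image

/-- An integral matrix, regarded as a real matrix. -/
abbrev castMat (A : Matrix κ ι ℤ) : Matrix κ ι ℝ := A.map Int.cast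

/-- The lattice `ℤ^ι` in `ℝ^ι`. -/
def stdLattice (ι : Type*) [Finite ι] : Submodule ℤ (ι → ℝ) :=
  Submodule.span ℤ (Set.range (Pi.basisFun ℝ ι))

theorem mem_stdLattice {ι : Type*} [Finite ι] {y : ι → ℝ} :
    y ∈ stdLattice ι ↔ ∀ i, ∃ n : ℤ, y i = n := by
  cases nonempty_fintype ι
  simp [stdLattice, Module.Basis.mem_span_iff_repr_mem, eq_comm]

theorem single_mem_stdLattice {ι : Type*} [Finite ι] [DecidableEq ι] (i : ι) :
    Pi.single i 1 ∈ stdLattice ι :=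
  Submodule.subset_span ⟨i, Pi.basisFun_apply ℝ ι i⟩

theorem mulVec_mem_stdLattice [Finite κ] (A : Matrix κ ι ℤ) {y : ι → ℝ} (hy : y ∈ stdLattice ι) :
    castMat A *ᵥ y ∈ stdLattice κ := by
  choose n hn using mem_stdLattice.1 hy
  exact mem_stdLattice.2 fun i => ⟨(A *ᵥ n) i, by simp [Matrix.mulVec, dotProduct, hn]⟩

variable [DecidableEq ι]

theorem castMat_mul_castMat_eq_one {ξ ζ : Matrix ι ι ℤ} (h : ξ * ζ = 1) :
    castMat ξ * castMat ζ = 1 := by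
  calc castMat ξ * castMat ζ = castMat (ξ * ζ) := (Matrix.map_mul (f := Int.castRingHom ℝ)).symm
    _ = 1 := by rw [h, castMat, Matrix.map_one _ Int.cast_zero Int.cast_one]

theorem exists_sub_mem_stdLattice_iff {ξ ζ : Matrix ι ι ℤ} (h : ξ * ζ = 1) {s : Set ι} {y : ι → ℝ} :
    (∃ w, (∀ i ∈ s, (castMat ξ *ᵥ w) i = 0) ∧ y - w ∈ stdLattice ι) ↔
      ∀ i ∈ s, ∃ n : ℤ, (castMat ξ *ᵥ y) i = n := by
  constructor
  · rintro ⟨w, hw, hyw⟩ i hi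
    have hint := mem_stdLattice.1 (mulVec_mem_stdLattice ξ hyw) i
    rwa [Matrix.mulVec_sub, Pi.sub_apply, hw i hi, sub_zero] at hint
  · intro hy
    classical
    have hN : s.indicator (castMat ξ *ᵥ y) ∈ stdLattice ι := mem_stdLattice.2 fun i => by
      by_cases hi : i ∈ s
      · simpa only [Set.indicator_of_mem hi] using hy i hi
      · exact ⟨0, by rw [Set.indicator_of_notMem hi, Int.cast_zero]⟩
    refine ⟨y - castMat ζ *ᵥ s.indicator (castMat ξ *ᵥ y), fun i hi => ?_, ?_⟩
    · rw [Matrix.mulVec_sub, Matrix.mulVec_mulVec, castMat_mul_castMat_eq_one h, Matrix.one_mulVec,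
        Pi.sub_apply, Set.indicator_of_mem hi, sub_self]
    · rw [sub_sub_cancel]
      exact mulVec_mem_stdLattice ζ hN

theorem IsRationalAffine.exists_eq_mk' {m k : ℕ} {W : AffineSubspace ℝ (Rn m)}
    (hW : IsRationalAffine k W) :
    ∃ (ξ ζ : Matrix (Fin m) (Fin m) ℤ) (a : Rn m), ξ * ζ = 1 ∧
      W = .mk' a (Submodule.span ℝ ((castMat ξ).row '' {i | (i : ℕ) < k})) := by
  obtain ⟨ξ, a, hdet, rfl⟩ := hW
  refine ⟨ξ, ξ⁻¹, a, Matrix.mul_nonsing_inv ξ (Int.isUnit_iff.2 hdet), ?_⟩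
  congr 2
  ext w
  exact exists_congr fun i => and_congr_right fun _ => eq_comm

end IntegralCoordinates

section MulVec

variable {ι κ : Type*} [Fintype ι]

/-- The continuous linear map of a real matrix. -/
abbrev mulVecCLM (A : Matrix κ ι ℝ) : (ι → ℝ) →L[ℝ] κ → ℝ :=
  A.mulVecLin.toContinuousLinearMap

theorem hasFDerivAt_mulVecCLM_add [Finite κ] (A : Matrix κ ι ℝ) (b : κ → ℝ) (x : ι → ℝ) :
    HasFDerivAt (fun x => A *ᵥ x + b) (mulVecCLM A) x := by
  cases nonempty_fintype κ
  exact (mulVecCLM A).hasFDerivAt.add_const b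

variable [DecidableEq ι]

theorem eq_mulVecCLM_iff {f : (ι → ℝ) →L[ℝ] κ → ℝ} {A : Matrix κ ι ℝ} :
    f = mulVecCLM A ↔ ∀ i j, f (Pi.single j 1) i = A i j := by
  refine ⟨?_, fun h => ContinuousLinearMap.coe_injective (LinearMap.pi_ext' fun j => ?_)⟩
  · rintro rfl i j
    simp
  · ext i
    simpa using h i j

theorem clm_apply_eq_dotProduct (α : (ι → ℝ) →L[ℝ] ℝ) (v : ι → ℝ) :
    α v = (fun i => α (Pi.single i 1)) ⬝ᵥ v := by
  conv_lhs => rw [pi_eq_sum_univ' v, map_sum]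
  exact Finset.sum_congr rfl fun i _ => by rw [map_smul, smul_eq_mul, mul_comm]

/-- Multiplication by an invertible real matrix, as a continuous linear equivalence. -/
def matEquiv {X Z : Matrix ι ι ℝ} (h : X * Z = 1) : (ι → ℝ) ≃L[ℝ] (ι → ℝ) :=
  (Matrix.toLin'OfInv (mul_eq_one_comm.1 h) h).toContinuousLinearEquiv

theorem matEquiv_apply {X Z : Matrix ι ι ℝ} (h : X * Z = 1) (v : ι → ℝ) :
    matEquiv h v = X *ᵥ v :=
  rfl

theorem coe_matEquiv {X Z : Matrix ι ι ℝ} (h : X * Z = 1) :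
    (matEquiv h : (ι → ℝ) →L[ℝ] (ι → ℝ)) = mulVecCLM X :=
  rfl

end MulVec

/-! ### Tropical charts -/

section Charts

variable {m : ℕ} {B : Type*} [TopologicalSpace B] [ChartedSpace (Rn m) B]

/-- The covector `∑ w_i dx_i` at `p`, as a function of its coefficients. -/
def cotanVec (e : TropChart m B) (p : B) : Rn m →ₗ[ℝ] Cotan m B p :=
  Fintype.linearCombination ℝ (dx e p)

theorem cotanVec_apply (e : TropChart m B) (p : B) (w : Rn m) (v : Tan m B p) :
    cotanVec e p w v = w ⬝ᵥ tanCoord e p v := by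
  simp [cotanVec, Fintype.linearCombination_apply, dx, dotProduct]

theorem cotanVec_single (e : TropChart m B) (p : B) (i : Fin m) :
    cotanVec e p (Pi.single i 1) = dx e p i := by
  simp [cotanVec, Fintype.linearCombination_apply_single]

theorem eventually_mem_transition_source {e e' : TropChart m B} {p : B}
    (hp : p ∈ e.1.source ∩ e'.1.source) :
    ∀ᶠ x in 𝓝 (e.1 p), x ∈ e.1.target ∧ e.1.symm x ∈ e'.1.source := by
  refine (e.1.symm.trans e'.1).open_source.eventually_mem ?_
  simp [e.1.map_source hp.1, hp.2, e.1.left_inv hp.1]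

variable [IsTropicalManifold m B]

theorem TropChart.mdifferentiable (e : TropChart m B) :
    e.1.MDifferentiable 𝓘(ℝ, Rn m) 𝓘(ℝ, Rn m) :=
  mdifferentiable_of_mem_atlas e.2

/-- The linear equivalence `tanCoord e p`, for `p` in the domain of the chart `e`. -/
def tanEquiv (e : TropChart m B) {p : B} (hp : p ∈ e.1.source) : Tan m B p ≃L[ℝ] Rn m :=
  (TropChart.mdifferentiable e).mfderiv hp

theorem tanCoord_tanEquiv_symm (e : TropChart m B) {p : B} (hp : p ∈ e.1.source) (y : Rn m) :
    tanCoord e p ((tanEquiv e hp).symm y) = y :=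
  (tanEquiv e hp).apply_symm_apply y

theorem tanCoord_tanVec (e : TropChart m B) {x : Rn m} (hx : x ∈ e.1.target) (y : Rn m) :
    tanCoord e (e.1.symm x) (tanVec e x y) = y :=
  DFunLike.congr_fun ((TropChart.mdifferentiable e).comp_symm_deriv hx) y

theorem tanVec_tanCoord (e : TropChart m B) {x : Rn m} (hx : x ∈ e.1.target)
    (v : Tan m B (e.1.symm x)) : tanVec e x (tanCoord e (e.1.symm x) v) = v :=
  (tanEquiv e (e.1.map_target hx)).injective (tanCoord_tanVec e hx _)

theorem exists_hasFDerivAt_transition {e e' : TropChart m B} {p : B}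
    (hp : p ∈ e.1.source ∩ e'.1.source) :
    ∃ A : Matrix (Fin m) (Fin m) ℤ,
      HasFDerivAt (fun x => e'.1 (e.1.symm x)) (mulVecCLM (castMat A)) (e.1 p) := by
  obtain ⟨A, b, h⟩ := IsTropicalManifold.transition e.1 e.2 e'.1 e'.2
  refine ⟨A, (hasFDerivAt_mulVecCLM_add _ b _).congr_of_eventuallyEq ?_⟩
  filter_upwards [eventually_mem_transition_source hp] with x hx
  rw [h _ ⟨e.1.map_target hx.1, hx.2⟩, e.1.right_inv hx.1]

theorem exists_transA_eq_castMat {e e' : TropChart m B} {p : B}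
    (hp : p ∈ e.1.source ∩ e'.1.source) :
    ∃ A : Matrix (Fin m) (Fin m) ℤ, transA e e' p = castMat A := by
  obtain ⟨A, hA⟩ := exists_hasFDerivAt_transition hp
  exact ⟨Aᵀ, Matrix.ext fun j i => eq_mulVecCLM_iff.1 hA.fderiv i j⟩

theorem hasFDerivAt_transition {e e' : TropChart m B} {p : B}
    (hp : p ∈ e.1.source ∩ e'.1.source) :
    HasFDerivAt (fun x => e'.1 (e.1.symm x)) (mulVecCLM (transA e e' p)ᵀ) (e.1 p) := by
  obtain ⟨A, hA⟩ := exists_hasFDerivAt_transition hp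
  have h : fderiv ℝ (fun x => e'.1 (e.1.symm x)) (e.1 p) = mulVecCLM (transA e e' p)ᵀ :=
    eq_mulVecCLM_iff.2 fun _ _ => rfl
  exact h ▸ hA.differentiableAt.hasFDerivAt

theorem tanCoord_eq_mulVec {e e' : TropChart m B} {p : B} (hp : p ∈ e.1.source ∩ e'.1.source)
    (v : Tan m B p) : tanCoord e' p v = (transA e e' p)ᵀ *ᵥ tanCoord e p v := by
  have hfactor : e'.1 =ᶠ[𝓝 p] (fun x => e'.1 (e.1.symm x)) ∘ e.1 := by
    filter_upwards [e.1.open_source.mem_nhds hp.1] with q hq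
    rw [Function.comp_apply, e.1.left_inv hq]
  have htransition := hasFDerivAt_transition hp
  have hchain := mfderiv_comp p htransition.differentiableAt.mdifferentiableAt
    ((TropChart.mdifferentiable e).mdifferentiableAt hp.1)
  rw [← hfactor.mfderiv_eq, mfderiv_eq_fderiv, htransition.fderiv] at hchain
  exact DFunLike.congr_fun hchain v

theorem cotanVec_transition {e e' : TropChart m B} {p : B} (hp : p ∈ e.1.source ∩ e'.1.source)
    (w : Rn m) : cotanVec e' p w = cotanVec e p (transA e e' p *ᵥ w) := by
  ext v
  rw [cotanVec_apply, cotanVec_apply, tanCoord_eq_mulVec hp, Matrix.dotProduct_mulVec,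
    Matrix.vecMul_transpose]

theorem cotanVec_injective (e : TropChart m B) {p : B} (hp : p ∈ e.1.source) :
    Function.Injective (cotanVec e p) := fun w w' h => by
  refine dotProduct_eq _ _ fun y => ?_
  simpa only [cotanVec_apply, tanCoord_tanEquiv_symm] using
    DFunLike.congr_fun h ((tanEquiv e hp).symm y)

theorem mem_lattice_iff (e : TropChart m B) {p : B} (hp : p ∈ e.1.source) {v : Tan m B p} :
    v ∈ lattice m B p ↔ tanCoord e p v ∈ stdLattice (Fin m) := by
  constructor
  · have hle : lattice m B p ≤
        (stdLattice (Fin m)).comap ((tanCoord e p).restrictScalars ℤ : Tan m B p →ₗ[ℤ] Rn m) := by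
      refine Submodule.span_le.2 ?_
      rintro v ⟨e', hp', i, hv⟩
      obtain ⟨A, hA⟩ := exists_transA_eq_castMat ⟨hp', hp⟩
      change tanCoord e p v ∈ stdLattice (Fin m)
      rw [tanCoord_eq_mulVec ⟨hp', hp⟩, hv, hA]
      exact mulVec_mem_stdLattice Aᵀ (single_mem_stdLattice i)
    exact fun hv => hle hv
  · have hle : stdLattice (Fin m) ≤ (lattice m B p).comap
        ((tanEquiv e hp).symm.toLinearMap.restrictScalars ℤ) := by
      refine Submodule.span_le.2 ?_
      rintro _ ⟨i, rfl⟩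
      refine Submodule.subset_span ⟨e, hp, i, ?_⟩
      rw [Pi.basisFun_apply]
      exact tanCoord_tanEquiv_symm e hp _
    exact fun hv => (tanEquiv e hp).symm_apply_apply v ▸ hle hv

theorem mem_dualLattice_iff (e : TropChart m B) {p : B} (hp : p ∈ e.1.source) {w : Rn m} :
    cotanVec e p w ∈ dualLattice m B p ↔ w ∈ stdLattice (Fin m) := by
  constructor
  · have hle : dualLattice m B p ≤
        (stdLattice (Fin m)).map ((cotanVec e p).restrictScalars ℤ) := by
      refine Submodule.span_le.2 ?_
      rintro _ ⟨e', hp', i, rfl⟩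
      obtain ⟨A, hA⟩ := exists_transA_eq_castMat ⟨hp, hp'⟩
      exact ⟨_, mulVec_mem_stdLattice A (single_mem_stdLattice i), by
        rw [LinearMap.restrictScalars_apply, ← hA, ← cotanVec_transition ⟨hp, hp'⟩,
          cotanVec_single]⟩
    intro hw
    obtain ⟨w', hw', h⟩ := hle hw
    exact cotanVec_injective e hp h ▸ hw'
  · have hle : stdLattice (Fin m) ≤
        (dualLattice m B p).comap ((cotanVec e p).restrictScalars ℤ) := by
      refine Submodule.span_le.2 ?_
      rintro _ ⟨i, rfl⟩
      refine Submodule.subset_span ⟨e, hp, i, ?_⟩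
      rw [Pi.basisFun_apply, LinearMap.restrictScalars_apply, cotanVec_single]
    exact fun hw => hle hw

end Charts

/-! ### The Legendre transform -/

section Legendre

variable {m : ℕ} {B : Type*} [TopologicalSpace B] [ChartedSpace (Rn m) B]
  (K : ConvexMultivalued m B)

section Chart

variable (e : TropChart m B)

theorem contDiffOn_legendre : ContDiffOn ℝ ∞ (legendre K e) e.1.target :=
  contDiffOn_pi.2 fun _ =>
    ((K.smooth e).fderiv_of_isOpen e.1.open_target (m := ∞) (by simp)).clm_apply contDiffOn_const

variable {x : Rn m}

theorem hess_posDef (hx : x ∈ e.1.target) : (hess K e x).PosDef :=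
  K.convex e x hx

theorem hess_transpose (hx : x ∈ e.1.target) : (hess K e x)ᵀ = hess K e x := by
  simpa using (hess_posDef K e hx).isHermitian.eq

theorem hasFDerivAt_legendre (hx : x ∈ e.1.target) :
    HasFDerivAt (legendre K e) (mulVecCLM (hess K e x)) x := by
  have hdiff : DifferentiableAt ℝ (legendre K e) x :=
    ((contDiffOn_legendre K e).contDiffAt (e.1.open_target.mem_nhds hx)).differentiableAt (by simp)
  have h : fderiv ℝ (legendre K e) x = mulVecCLM (hess K e x)ᵀ :=
    eq_mulVecCLM_iff.2 fun i j => by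
      rw [Matrix.transpose_apply, hess, Matrix.of_apply,
        (hasFDerivAt_pi'.1 hdiff.hasFDerivAt i).fderiv]
      rfl
  rw [← hess_transpose K e hx, ← h]
  exact hdiff.hasFDerivAt

end Chart

theorem hasFDerivAt_potential (e : TropChart m B) {p : B} (hp : p ∈ e.1.source) :
    HasFDerivAt (fun x => K.K e (e.1.symm x))
      (fderiv ℝ (fun x => K.K e (e.1.symm x)) (e.1 p)) (e.1 p) :=
  (((K.smooth e).contDiffAt (e.1.open_target.mem_nhds (e.1.map_source hp))).differentiableAt
    (by simp)).hasFDerivAt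

variable [IsTropicalManifold m B]

theorem hasFDerivAt_potential_transition {e e' : TropChart m B} {p : B}
    (hp : p ∈ e.1.source ∩ e'.1.source) :
    HasFDerivAt (fun x => K.K e' (e.1.symm x))
      (fderiv ℝ (fun x => K.K e' (e'.1.symm x)) (e'.1 p) ∘L mulVecCLM (transA e e' p)ᵀ)
      (e.1 p) := by
  have hfactor : (fun x => K.K e' (e.1.symm x)) =ᶠ[𝓝 (e.1 p)]
      (fun x => K.K e' (e'.1.symm x)) ∘ fun x => e'.1 (e.1.symm x) := by
    filter_upwards [eventually_mem_transition_source hp] with x hx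
    rw [Function.comp_apply, e'.1.left_inv hx.2]
  refine HasFDerivAt.congr_of_eventuallyEq (.comp (e.1 p) ?_ (hasFDerivAt_transition hp)) hfactor
  rw [e.1.left_inv hp.1]
  exact hasFDerivAt_potential K e' hp.2

theorem legendre_transition {e e' : TropChart m B} {p : B} (hp : p ∈ e.1.source ∩ e'.1.source) :
    legendre K e (e.1 p) = transA e e' p *ᵥ legendre K e' (e'.1 p) + transB K e e' p := by
  ext j
  have hB : transB K e e' p j =
      legendre K e (e.1 p) j - legendre K e' (e'.1 p) ⬝ᵥ (transA e e' p)ᵀ *ᵥ Pi.single j 1 := by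
    rw [transB, ((hasFDerivAt_potential K e hp.1).fun_sub
      (hasFDerivAt_potential_transition K hp)).fderiv, sub_apply,
      ContinuousLinearMap.comp_apply, clm_apply_eq_dotProduct
        (fderiv ℝ (fun x => K.K e' (e'.1.symm x)) (e'.1 p))]
    rfl
  rw [Pi.add_apply, hB, Matrix.dotProduct_mulVec, Matrix.vecMul_transpose, dotProduct_single,
    mul_one, add_sub_cancel]

end Legendre

/-! ### `L(V, Y)` and `C(V)` in a chart -/

section Glue

variable {m : ℕ} {B : Type*} [TopologicalSpace B] [ChartedSpace (Rn m) B]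
  {K : ConvexMultivalued m B} {k : ℕ} {V : AffineSection K k} {e e' : TropChart m B} {p : B}

theorem AffineSection.direction_eq_map (hp : p ∈ e.1.source ∩ e'.1.source) :
    (V.loc e p).direction = (V.loc e' p).direction.map (transA e e' p).mulVecLin := by
  let f : Rn m →ᵃ[ℝ] Rn m :=
    (transA e e' p).mulVecLin.toAffineMap + AffineMap.const ℝ (Rn m) (transB K e e' p)
  have hmap : V.loc e p = (V.loc e' p).map f := SetLike.coe_injective (V.glue e e' p hp)
  rw [hmap, AffineSubspace.map_direction]
  congr 1
  simp [f]

variable [IsTropicalManifold m B]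

theorem AffineSection.mem_localBase_of_mem (hp : p ∈ e.1.source) (h : p ∈ V.localBase e') :
    p ∈ V.localBase e := by
  refine ⟨hp, ?_⟩
  rw [legendre_transition K ⟨hp, h.1⟩, ← SetLike.mem_coe, V.glue e e' p ⟨hp, h.1⟩]
  exact Set.mem_image_of_mem _ h.2

theorem AffineSection.mem_base_iff (hp : p ∈ e.1.source) : p ∈ V.base ↔ p ∈ V.localBase e :=
  ⟨fun h => mem_localBase_of_mem hp (Set.mem_iUnion.1 h).choose_spec,
    fun h => Set.mem_iUnion.2 ⟨e, h⟩⟩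

theorem AffineSection.dotProduct_tanCoord_eq_zero (hp : p ∈ e.1.source ∩ e'.1.source)
    {u : Tan m B p} (hu : ∀ d ∈ (V.loc e' p).direction, d ⬝ᵥ tanCoord e' p u = 0) :
    ∀ d ∈ (V.loc e p).direction, d ⬝ᵥ tanCoord e p u = 0 := by
  rw [AffineSection.direction_eq_map hp]
  rintro _ ⟨d, hd, rfl⟩
  rw [Matrix.mulVecLin_apply, ← Matrix.vecMul_transpose, ← Matrix.dotProduct_mulVec,
    ← tanCoord_eq_mulVec hp]
  exact hu d hd

variable {Y : ∀ p : B, Tan m B p}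

theorem mk_mem_lagrangian_iff {v : Tan m B p} :
    (⟨p, Submodule.Quotient.mk v⟩ : XB m B) ∈ lagrangian V Y ↔
      ∃ e : TropChart m B, p ∈ V.localBase e ∧ ∃ u : Tan m B p,
        (∀ d ∈ (V.loc e p).direction, d ⬝ᵥ tanCoord e p u = 0) ∧
        v - (u + Y p) ∈ lattice m B p := by
  constructor
  · rintro ⟨e, x, w, hx, hb, hw, h⟩
    obtain ⟨rfl, h⟩ := Sigma.mk.inj_iff.1 h
    refine ⟨e, hb, tanVec e x w, fun d hd => ?_, (Submodule.Quotient.eq _).1 (eq_of_heq h)⟩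
    rw [tanCoord_tanVec e hx]
    exact hw d hd
  · rintro ⟨e, hb, u, hu, h⟩
    obtain ⟨x, hx, rfl⟩ : ∃ x ∈ e.1.target, e.1.symm x = p :=
      ⟨e.1 p, e.1.map_source hb.1, e.1.left_inv hb.1⟩
    refine ⟨e, x, tanCoord e _ u, hx, hb, hu, ?_⟩
    rw [tanVec_tanCoord e hx, (Submodule.Quotient.eq _).2 h]

theorem xPoint_mem_lagrangian_iff {z : Rn m × Rn m} (hz : z.1 ∈ e.1.target) :
    xPoint e z ∈ lagrangian V Y ↔ e.1.symm z.1 ∈ V.localBase e ∧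
      ∃ w : Rn m, (∀ d ∈ (V.loc e (e.1.symm z.1)).direction, d ⬝ᵥ w = 0) ∧
        z.2 - vecCoord Y e z.1 - w ∈ stdLattice (Fin m) := by
  have hp := e.1.map_target hz
  have hlattice : ∀ u, tanVec e z.1 z.2 - (u + Y (e.1.symm z.1)) ∈ lattice m B (e.1.symm z.1) ↔
      z.2 - vecCoord Y e z.1 - tanCoord e _ u ∈ stdLattice (Fin m) := fun u => by
    rw [mem_lattice_iff e hp, map_sub, map_add, tanCoord_tanVec e hz, vecCoord, sub_sub, add_comm]
  refine mk_mem_lagrangian_iff.trans ⟨?_, ?_⟩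
  · rintro ⟨e', hb, u, hu, h⟩
    exact ⟨AffineSection.mem_localBase_of_mem hp hb, tanCoord e _ u,
      AffineSection.dotProduct_tanCoord_eq_zero ⟨hp, hb.1⟩ hu, (hlattice u).1 h⟩
  · rintro ⟨hb, w, hw, h⟩
    refine ⟨e, hb, tanVec e z.1 w, ?_, (hlattice _).2 ?_⟩ <;> rwa [tanCoord_tanVec e hz]

theorem wPoint_mem_complexSub_iff {z : Rn m × Rn m} (hz : z.1 ∈ e.1.target) :
    wPoint e z ∈ complexSub V ↔ e.1.symm z.1 ∈ V.localBase e ∧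
      ∃ w ∈ (V.loc e (e.1.symm z.1)).direction, z.2 - w ∈ stdLattice (Fin m) := by
  have hp := e.1.map_target hz
  have hlattice : ∀ w : Rn m, (Submodule.Quotient.mk (cotanVec e _ z.2) :
      Cotan m B (e.1.symm z.1) ⧸ dualLattice m B _) = Submodule.Quotient.mk (cotanVec e _ w) ↔
      z.2 - w ∈ stdLattice (Fin m) := fun w => by
    rw [Submodule.Quotient.eq, ← map_sub, mem_dualLattice_iff e hp]
  constructor
  · rintro ⟨e', p, w, hb, hw, h⟩
    obtain ⟨rfl, h⟩ := Sigma.mk.inj_iff.1 h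
    have h : Submodule.Quotient.mk (cotanVec e _ z.2) = Submodule.Quotient.mk (cotanVec e' _ w) :=
      eq_of_heq h
    rw [cotanVec_transition ⟨hp, hb.1⟩, hlattice] at h
    refine ⟨AffineSection.mem_localBase_of_mem hp hb, _, ?_, h⟩
    rw [AffineSection.direction_eq_map ⟨hp, hb.1⟩]
    exact Submodule.mem_map_of_mem hw
  · rintro ⟨hb, w, hw, h⟩
    exact ⟨e, _, w, hb, hw, Sigma.mk.inj_iff.2 ⟨rfl, heq_of_eq ((hlattice w).2 h)⟩⟩

end Glue

/-! ### Linear models of the tangent spaces -/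

section CoordinateInclusion

variable {ι κ : Type*} [DecidableEq ι] {f : κ → ι}

/-- The matrix whose `i`-th column is the standard basis vector with index `f i`. In coordinates
adapted to `V`, the linear part of `V` is the image of this matrix for `f = Fin.castLE hk`. -/
def coordIncl (f : κ → ι) : Matrix ι κ ℝ :=
  (1 : Matrix ι ι ℝ).submatrix id f

theorem coordIncl_apply (f : κ → ι) (i : ι) (l : κ) :
    coordIncl f i l = (1 : Matrix ι ι ℝ) i (f l) :=
  rfl

theorem coordIncl_transpose_mulVec [Fintype ι] (f : κ → ι) (s : ι → ℝ) :
    (coordIncl f)ᵀ *ᵥ s = s ∘ f := by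
  ext l
  simp [Matrix.mulVec, dotProduct, coordIncl_apply, Matrix.one_apply]

theorem coordIncl_transpose_mul_coordIncl [Fintype ι] [DecidableEq κ]
    (hf : Function.Injective f) : (coordIncl f)ᵀ * coordIncl f = 1 := by
  rw [coordIncl, Matrix.transpose_submatrix, Matrix.transpose_one,
    ← Matrix.submatrix_mul _ _ f id f Function.bijective_id, one_mul, Matrix.submatrix_one f hf]

variable [Fintype κ]

theorem coordIncl_mulVec_apply_of_notMem_range {i : ι} (hi : i ∉ Set.range f) (s : κ → ℝ) :
    (coordIncl f *ᵥ s) i = 0 :=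
  Finset.sum_eq_zero fun l _ => by
    have hzero : coordIncl f i l = 0 := Matrix.one_apply_ne fun h => hi ⟨l, h.symm⟩
    exact mul_eq_zero_of_left hzero _

theorem coordIncl_mulVec_comp (hf : Function.Injective f) {s : ι → ℝ}
    (hs : ∀ i ∈ (Set.range f)ᶜ, s i = 0) : coordIncl f *ᵥ (s ∘ f) = s := by
  classical
  ext i
  by_cases hi : i ∈ Set.range f
  · obtain ⟨l, rfl⟩ := hi
    simp [Matrix.mulVec, dotProduct, coordIncl_apply, Matrix.one_apply, hf.eq_iff]
  · rw [coordIncl_mulVec_apply_of_notMem_range hi, hs i hi]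

theorem coordIncl_mulVec_injective (hf : Function.Injective f) :
    Function.Injective (coordIncl f).mulVec := by
  classical
  refine Function.LeftInverse.injective (g := fun s => s ∘ f) fun s => funext fun l => ?_
  simp [Matrix.mulVec, dotProduct, coordIncl_apply, Matrix.one_apply, hf.eq_iff]

/-- The orthogonal projection onto the coordinate subspace of the indices in the range of `f`. -/
def coordProj (f : κ → ι) : Matrix ι ι ℝ :=
  coordIncl f * (coordIncl f)ᵀ

variable [Fintype ι]

theorem coordProj_mulVec (hf : Function.Injective f) (s : ι → ℝ) :
    coordProj f *ᵥ s = (Set.range f).indicator s := by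
  have hcomp : s ∘ f = (Set.range f).indicator s ∘ f :=
    funext fun l => (Set.indicator_of_mem (Set.mem_range_self l) s).symm
  rw [coordProj, ← Matrix.mulVec_mulVec, coordIncl_transpose_mulVec, hcomp,
    coordIncl_mulVec_comp hf fun i hi => Set.indicator_of_notMem hi s]

/-- The linear model of `L(V,Y)`: it sends a vector to its component tangent to `B(V)` and its
component along the fibre. -/
def lagrangianModel (f : κ → ι) : (ι → ℝ) →ₗ[ℝ] (ι → ℝ) × (ι → ℝ) :=
  (coordProj f).mulVecLin.prod (1 - coordProj f).mulVecLin

theorem lagrangianModel_injective : Function.Injective (lagrangianModel f) := fun s s' h => by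
  have hsum := congrArg (fun w => w.1 + w.2) h
  simpa [lagrangianModel, Matrix.sub_mulVec] using hsum

theorem range_lagrangianModel (hf : Function.Injective f) :
    LinearMap.range (lagrangianModel f) = coordSubspace (Set.range f)ᶜ (Set.range f) := by
  have hmodel : ∀ s, lagrangianModel f s =
      ((Set.range f).indicator s, s - (Set.range f).indicator s) := fun s => by
    simp [lagrangianModel, coordProj_mulVec hf]
  ext w
  rw [mem_coordSubspace]
  constructor
  · rintro ⟨s, rfl⟩
    rw [hmodel]
    exact ⟨fun i hi => Set.indicator_of_notMem hi s,
      fun i hi => sub_eq_zero.2 (Set.indicator_of_mem hi s).symm⟩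
  · rintro ⟨h₁, h₂⟩
    have hfst : (Set.range f).indicator (w.1 + w.2) = w.1 := by
      ext i
      by_cases hi : i ∈ Set.range f
      · rw [Set.indicator_of_mem hi, Pi.add_apply, h₂ i hi, add_zero]
      · rw [Set.indicator_of_notMem hi, h₁ i hi]
    exact ⟨w.1 + w.2, by rw [hmodel, hfst, add_sub_cancel_left]⟩

end CoordinateInclusion

section ComplexModel

variable {ι κ : Type*}

/-- The real parts of the components of a complex vector. -/
def reVec : (κ → ℂ) →ₗ[ℝ] κ → ℝ :=
  Complex.reLm.compLeft κ

/-- The imaginary parts of the components of a complex vector. -/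
def imVec : (κ → ℂ) →ₗ[ℝ] κ → ℝ :=
  Complex.imLm.compLeft κ

theorem reVec_I_smul (u : κ → ℂ) : reVec (Complex.I • u) = -imVec u :=
  funext fun i => Complex.I_mul_re (u i)

theorem imVec_I_smul (u : κ → ℂ) : imVec (Complex.I • u) = reVec u :=
  funext fun i => Complex.I_mul_im (u i)

theorem exists_reVec_eq_imVec_eq (p q : κ → ℝ) : ∃ u : κ → ℂ, reVec u = p ∧ imVec u = q :=
  ⟨fun i => ⟨p i, q i⟩, rfl, rfl⟩

variable [Fintype κ] [DecidableEq ι] {f : κ → ι}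

/-- The linear model of `C(V)`. -/
def complexModel (f : κ → ι) : (κ → ℂ) →ₗ[ℝ] (ι → ℝ) × (ι → ℝ) :=
  ((coordIncl f).mulVecLin ∘ₗ reVec).prod ((coordIncl f).mulVecLin ∘ₗ imVec)

theorem complexModel_injective (hf : Function.Injective f) :
    Function.Injective (complexModel f) := fun u u' h => by
  have hre := coordIncl_mulVec_injective hf (congrArg Prod.fst h)
  have him := coordIncl_mulVec_injective hf (congrArg Prod.snd h)
  exact funext fun i => Complex.ext (congrFun hre i) (congrFun him i)

theorem range_complexModel (hf : Function.Injective f) :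
    LinearMap.range (complexModel f) = coordSubspace (Set.range f)ᶜ (Set.range f)ᶜ := by
  ext w
  rw [mem_coordSubspace]
  constructor
  · rintro ⟨u, rfl⟩
    exact ⟨fun i hi => coordIncl_mulVec_apply_of_notMem_range hi _,
      fun i hi => coordIncl_mulVec_apply_of_notMem_range hi _⟩
  · rintro ⟨h₁, h₂⟩
    obtain ⟨u, hre, him⟩ := exists_reVec_eq_imVec_eq (w.1 ∘ f) (w.2 ∘ f)
    refine ⟨u, Prod.ext ?_ ?_⟩
    · exact (congrArg _ hre).trans (coordIncl_mulVec_comp hf h₁)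
    · exact (congrArg _ him).trans (coordIncl_mulVec_comp hf h₂)

end ComplexModel

section LinearAlgebra

variable {ι κ : Type*} [Fintype ι]

theorem isSymm_iff_dotProduct_mulVec_comm {R : Type*} [CommSemiring R] {N : Matrix ι ι R} :
    N.IsSymm ↔ ∀ s t : ι → R, s ⬝ᵥ N *ᵥ t = t ⬝ᵥ N *ᵥ s := by
  classical
  constructor
  · intro h s t
    rw [Matrix.dotProduct_mulVec, ← Matrix.mulVec_transpose, h.eq, dotProduct_comm]
  · intro h
    exact Matrix.IsSymm.ext fun i j => by
      simpa using h (Pi.single j 1) (Pi.single i 1)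

theorem det_mul_mul_add_smul_one_sub [Fintype κ] [DecidableEq ι] [DecidableEq κ] {F : Type*}
    [Field F] {c : F} (hc : c ≠ 0) (hcard : Fintype.card κ ≤ Fintype.card ι) (A : Matrix ι ι F)
    {J : Matrix ι κ F} {J' : Matrix κ ι F} (h : J' * J = 1) :
    (A * (J * J') + c • (1 - J * J')).det =
      c ^ (Fintype.card ι - Fintype.card κ) * (J' * A * J).det := by
  have hfactor : A * (J * J') + c • (1 - J * J') = c • (1 + (c⁻¹ • (A * J) - J) * J') := by
    rw [Matrix.sub_mul, smul_add, smul_sub, Matrix.smul_mul, smul_sub, smul_inv_smul₀ hc,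
      Matrix.mul_assoc]
    abel
  have hsmall : 1 + J' * (c⁻¹ • (A * J) - J) = c⁻¹ • (J' * A * J) := by
    rw [Matrix.mul_sub, h, Matrix.mul_smul, Matrix.mul_assoc, add_sub_cancel]
  rw [hfactor, Matrix.det_smul, Matrix.det_one_add_mul_comm, hsmall, Matrix.det_smul, ← mul_assoc,
    inv_pow, pow_sub₀ c hc hcard]

theorem im_mul_ofReal_eq_zero_iff {z : ℂ} {r : ℝ} (hr : r ≠ 0) : (z * r).im = 0 ↔ z.im = 0 := by
  rw [Complex.im_mul_ofReal, mul_eq_zero, or_iff_left hr]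

end LinearAlgebra

/-! ### Complexification -/

section Complexification

variable {ι κ l : Type*}

/-- The complex vector with the given real components. -/
abbrev complexVec (s : ι → ℝ) : ι → ℂ := fun i => s i

/-- A real matrix, regarded as a complex matrix. -/
abbrev complexMat (A : Matrix κ ι ℝ) : Matrix κ ι ℂ := A.map Complex.ofReal

theorem complexMat_add (A B : Matrix κ ι ℝ) :
    complexMat (A + B) = complexMat A + complexMat B :=
  A.map_add _ Complex.ofReal_add B

theorem complexMat_sub (A B : Matrix κ ι ℝ) :
    complexMat (A - B) = complexMat A - complexMat B :=
  A.map_sub _ Complex.ofReal_sub B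

theorem complexMat_one [DecidableEq ι] : complexMat (1 : Matrix ι ι ℝ) = 1 :=
  Matrix.map_one _ Complex.ofReal_zero Complex.ofReal_one

theorem det_complexMat [Fintype ι] [DecidableEq ι] (A : Matrix ι ι ℝ) :
    (complexMat A).det = A.det :=
  (Complex.ofRealHom.map_det A).symm

variable [Fintype ι]

theorem complexMat_mul (A : Matrix κ ι ℝ) (B : Matrix ι l ℝ) :
    complexMat (A * B) = complexMat A * complexMat B :=
  Matrix.map_mul (f := Complex.ofRealHom)

theorem complexMat_mulVec_complexVec (A : Matrix κ ι ℝ) (s : ι → ℝ) :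
    complexMat A *ᵥ complexVec s = complexVec (A *ᵥ s) :=
  funext fun i => (Complex.ofRealHom.map_mulVec A s i).symm

theorem complexVec_dotProduct (s t : ι → ℝ) :
    complexVec s ⬝ᵥ complexVec t = ((s ⬝ᵥ t : ℝ) : ℂ) :=
  (Complex.ofRealHom.map_dotProduct s t).symm

end Complexification

section HolomorphicCoordinates

variable {m : ℕ}

theorem dz_eq (v : Rn m × Rn m) : dz v = complexVec v.1 + Complex.I • complexVec v.2 :=
  rfl

theorem dz_add (v w : Rn m × Rn m) : dz (v + w) = dz v + dz w := by
  ext i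
  simp only [dz, Prod.fst_add, Pi.add_apply, Complex.ofReal_add, Prod.snd_add]
  ring

theorem dz_reVec_imVec (u : Fin m → ℂ) : dz (reVec u, imVec u) = u :=
  funext fun i => by rw [dz, mul_comm]; exact Complex.re_add_im (u i)

theorem dz_mulVec {κ : Type*} [Fintype κ] (A B : Matrix (Fin m) κ ℝ) (s : κ → ℝ) :
    dz (A *ᵥ s, B *ᵥ s) = (complexMat A + Complex.I • complexMat B) *ᵥ complexVec s := by
  rw [dz_eq, Matrix.add_mulVec, Matrix.smul_mulVec, complexMat_mulVec_complexVec,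
    complexMat_mulVec_complexVec]

theorem dz_mulVec_mulVec {n : ℕ} (A : Matrix (Fin m) (Fin n) ℝ) (v : Rn n × Rn n) :
    dz (A *ᵥ v.1, A *ᵥ v.2) = complexMat A *ᵥ dz v := by
  rw [dz_eq, dz_eq, Matrix.mulVec_add, Matrix.mulVec_smul, complexMat_mulVec_complexVec,
    complexMat_mulVec_complexVec]

end HolomorphicCoordinates

/-! ### Kähler form, curvature and volume forms -/

section Forms

variable {m : ℕ} {B : Type*} [TopologicalSpace B] [ChartedSpace (Rn m) B]

theorem dz_dotProduct_mulVec_star_dz (A : Matrix (Fin m) (Fin m) ℝ) (v w : Rn m × Rn m) :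
    dz v ⬝ᵥ complexMat A *ᵥ star (dz w) = ((v.1 ⬝ᵥ A *ᵥ w.1 + v.2 ⬝ᵥ A *ᵥ w.2 : ℝ) : ℂ) +
      Complex.I * ((v.2 ⬝ᵥ A *ᵥ w.1 - v.1 ⬝ᵥ A *ᵥ w.2 : ℝ) : ℂ) := by
  have hstar : star (dz w) = complexVec w.1 - Complex.I • complexVec w.2 := by
    ext i
    simp [dz, sub_eq_add_neg]
  rw [hstar, dz_eq, Matrix.mulVec_sub, Matrix.mulVec_smul, complexMat_mulVec_complexVec,
    complexMat_mulVec_complexVec]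
  simp only [add_dotProduct, dotProduct_sub, smul_dotProduct, dotProduct_smul,
    complexVec_dotProduct, smul_eq_mul]
  push_cast
  linear_combination -((v.2 ⬝ᵥ A *ᵥ w.2 : ℝ) : ℂ) * Complex.I_sq

theorem omegaX_eq (K : ConvexMultivalued m B) (e : TropChart m B) {z : Rn m × Rn m}
    (hz : z.1 ∈ e.1.target) (v w : Rn m × Rn m) :
    omegaX K e z v w =
      (((hess K e z.1 *ᵥ v.1) ⬝ᵥ w.2 - (hess K e z.1 *ᵥ w.1) ⬝ᵥ v.2 : ℝ) : ℂ) := by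
  have hform : omegaX K e z v w = Complex.I / 2 *
      (dz v ⬝ᵥ complexMat (hess K e z.1) *ᵥ star (dz w) -
        dz w ⬝ᵥ complexMat (hess K e z.1) *ᵥ star (dz v)) := by
    simp only [omegaX, dotProduct, Matrix.mulVec, Finset.mul_sum, ← Finset.sum_sub_distrib]
    refine Finset.sum_congr rfl fun i _ => Finset.sum_congr rfl fun j _ => ?_
    simp only [Matrix.map_apply, Pi.star_apply, starRingEnd_apply]
    ring
  have hsymm : ∀ s t : Rn m, s ⬝ᵥ hess K e z.1 *ᵥ t = t ⬝ᵥ hess K e z.1 *ᵥ s := fun s t => by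
    rw [Matrix.dotProduct_mulVec, ← Matrix.mulVec_transpose, hess_transpose K e hz,
      dotProduct_comm]
  rw [hform, dz_dotProduct_mulVec_star_dz, dz_dotProduct_mulVec_star_dz, hsymm v.1 w.1,
    hsymm v.2 w.2, hsymm v.1 w.2, hsymm w.1 v.2, dotProduct_comm (_ *ᵥ v.1),
    dotProduct_comm (_ *ᵥ w.1)]
  push_cast
  linear_combination ((v.2 ⬝ᵥ hess K e z.1 *ᵥ w.1 : ℝ) - (w.2 ⬝ᵥ hess K e z.1 *ᵥ v.1 : ℝ) : ℂ) *
    Complex.I_sq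

theorem curvature_eq_fderiv_sub_fderiv {P : Type*} [NormedAddCommGroup P] [NormedSpace ℝ P]
    {α : P → P →L[ℝ] ℂ} {u : P} (hα : DifferentiableAt ℝ α u) (v w : P) :
    curvature α u v w = fderiv ℝ (fun u => α u w) u v - fderiv ℝ (fun u => α u v) u w := by
  have hdiff : DifferentiableAt ℝ (fun u' => toForm (α u')) u :=
    (ContinuousAlternatingMap.ofSubsingletonLIE (𝕜 := ℝ) (E := P) (F := ℂ)
      (0 : Fin 1)).differentiable.differentiableAt.comp u hα
  have hremove₀ : (0 : Fin 2).removeNth ![v, w] = ![w] := by ext i; fin_cases i; rfl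
  have hremove₁ : (1 : Fin 2).removeNth ![v, w] = ![v] := by ext i; fin_cases i; rfl
  have hform : ∀ w, (fun u' => toForm (α u') ![w]) = fun u' => α u' w := fun w => rfl
  rw [curvature, extDeriv_apply hdiff, Fin.sum_univ_two, hremove₀, hremove₁, hform, hform]
  simp [sub_eq_add_neg]

theorem pullback_connForm_apply {k : ℕ} (Y : ∀ p : B, Tan m B p) (e : TropChart m B)
    (φ : (Fin k → ℂ) → Rn m × Rn m) (u w : Fin k → ℂ) :
    pullback (connForm Y e) φ u w =
      Complex.I * ((vecCoord Y e (φ u).1 ⬝ᵥ (fderiv ℝ φ u w).2 : ℝ) : ℂ) := by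
  simp [pullback, connForm, dotProduct, Finset.mul_sum, mul_assoc]

theorem curvature_pullback_connForm {k : ℕ} {Y : ∀ p : B, Tan m B p} {e : TropChart m B}
    {φ : (Fin k → ℂ) → Rn m × Rn m} {u : Fin k → ℂ} (hφ : ContDiffAt ℝ 2 φ u)
    {L : (Fin k → ℂ) →L[ℝ] Rn m} (hL : HasFDerivAt (fun u => vecCoord Y e (φ u).1) L u)
    (v w : Fin k → ℂ) :
    curvature (pullback (connForm Y e) φ) u v w = Complex.I *
      ((L v ⬝ᵥ (fderiv ℝ φ u w).2 - L w ⬝ᵥ (fderiv ℝ φ u v).2 : ℝ) : ℂ) := by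
  have hφ' : HasFDerivAt (fderiv ℝ φ) (fderiv ℝ (fderiv ℝ φ) u) u :=
    ((hφ.fderiv_right (m := 1) (by norm_num)).differentiableAt (by simp)).hasFDerivAt
  have hsymm : fderiv ℝ (fderiv ℝ φ) u v w = fderiv ℝ (fderiv ℝ φ) u w v :=
    hφ.isSymmSndFDerivAt (by simp) v w
  have hvalue : ∀ w, HasFDerivAt (fun u => (fderiv ℝ φ u w).2)
      (.snd ℝ _ _ ∘L (fderiv ℝ (fderiv ℝ φ) u).flip w) u := fun w => by
    simpa using (hφ'.clm_apply (hasFDerivAt_const w u)).snd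
  have hform : ∀ w, HasFDerivAt (fun u => pullback (connForm Y e) φ u w) _ u := fun w => by
    simp only [pullback_connForm_apply]
    exact (Complex.ofRealCLM.hasFDerivAt.comp u
      ((dotProductBilin ℝ ℝ).toContinuousBilinearMap.hasFDerivAt_of_bilinear hL
        (hvalue w))).const_mul Complex.I
  have hdiff : DifferentiableAt ℝ (pullback (connForm Y e) φ) u :=
    .clm_comp (.fun_sum fun j _ => .smul_const ((Complex.ofRealCLM.differentiableAt.comp u
      (differentiableAt_pi.1 hL.differentiableAt j)).const_mul _) _) hφ'.differentiableAt
  rw [curvature_eq_fderiv_sub_fderiv hdiff, (hform w).fderiv, (hform v).fderiv]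
  simp only [ContinuousLinearMap.precompR_apply, ContinuousLinearMap.precompL_apply,
    ContinuousLinearMap.compL_apply, ContinuousLinearMap.comp_add, ContinuousLinearMap.comp_apply,
    ContinuousLinearMap.flip_apply, ContinuousLinearMap.coe_snd', add_apply, smul_apply, smul_add,
    LinearMap.toContinuousBilinearMap_apply, dotProductBilin_apply_apply, hsymm,
    Complex.ofRealCLM_apply, smul_eq_mul, add_sub_add_left_eq_sub, Complex.ofReal_sub]
  ring

theorem OmegaX_eq_det_mul_det {P : Type*} {T : P → Rn m × Rn m} {Q : Matrix (Fin m) (Fin m) ℂ}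
    {c : P → Rn m} (hT : ∀ v, dz (T v) = Q *ᵥ complexVec (c v)) (a : Fin m → P) :
    OmegaX (fun j => T (a j)) = Q.det * ((Matrix.of fun i j => c (a j) i).det : ℝ) := by
  rw [← det_complexMat, ← Matrix.det_mul, OmegaX]
  congr 1
  ext i j
  exact congrFun (hT (a j)) i

theorem forall_im_mul_OmegaX_eq_zero_iff {P : Type*} {T : P → Rn m × Rn m}
    {Q : Matrix (Fin m) (Fin m) ℂ} {c : P → Rn m} (hc : Function.Surjective c)
    (hT : ∀ v, dz (T v) = Q *ᵥ complexVec (c v)) (t : ℂ) :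
    (∀ a : Fin m → P, (t * OmegaX fun j => T (a j)).im = 0) ↔ (t * Q.det).im = 0 := by
  simp only [OmegaX_eq_det_mul_det hT, ← mul_assoc, Complex.im_mul_ofReal]
  refine ⟨fun h => ?_, fun h a => by rw [h, zero_mul]⟩
  choose a ha using fun j : Fin m => hc (Pi.single j 1)
  have hone : (Matrix.of fun i j => c (a j) i) = 1 := by
    ext i j
    simp [ha, Matrix.one_apply, Pi.single_apply]
  simpa [hone] using h a

theorem wedgePow_eq_det_mul_det {P : Type*} {k : ℕ} {β : P → P → ℂ}
    {Z : Matrix (Fin k) (Fin k) ℂ} {c : P → Fin k × Fin 2 → ℝ}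
    (hβ : ∀ v w, β v w = pairForm Z (complexVec (c v)) (complexVec (c w)))
    (a : Fin k × Fin 2 → P) :
    wedgePow k β a = Z.det * ((k.factorial * (Matrix.of fun s => c (a s)).det : ℝ) : ℂ) := by
  have hwedge : wedgePow k β a =
      wedgePow k (fun v w => pairForm Z v w) fun s => complexVec (c (a s)) := by
    simp only [wedgePow, hβ]
  have hdet : (Matrix.of fun s => complexVec (c (a s))).det =
      ((Matrix.of fun s => c (a s)).det : ℝ) := det_complexMat (Matrix.of fun s => c (a s))
  rw [hwedge, wedgePow_pairForm, hdet]
  push_cast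
  ring

theorem forall_im_mul_wedgePow_eq_zero_iff {P : Type*} {k : ℕ} {β : P → P → ℂ}
    {Z : Matrix (Fin k) (Fin k) ℂ} {c : P → Fin k × Fin 2 → ℝ} (hc : Function.Surjective c)
    (hβ : ∀ v w, β v w = pairForm Z (complexVec (c v)) (complexVec (c w))) (t : ℂ) :
    (∀ a : Fin k × Fin 2 → P, (t * wedgePow k β a).im = 0) ↔ (t * Z.det).im = 0 := by
  simp only [wedgePow_eq_det_mul_det hβ, ← mul_assoc t, Complex.im_mul_ofReal]
  refine ⟨fun h => ?_, fun h a => by rw [h, zero_mul]⟩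
  choose a ha using fun s : Fin k × Fin 2 => hc (Pi.single s 1)
  have hone : (Matrix.of fun s => c (a s)) = 1 := by
    ext s t
    simp [ha, Matrix.one_apply, Pi.single_apply, eq_comm]
  simpa [hone, Nat.factorial_ne_zero] using h a

end Forms

/-! ### Flat charts of a constant section -/

section FlatCharts

variable {m : ℕ} {B : Type*} [TopologicalSpace B] [ChartedSpace (Rn m) B]
  {K : ConvexMultivalued m B} {k : ℕ} {V : AffineSection K k} {e : TropChart m B}

/-- An integral basis (the rows of `basis`, with inverse matrix `dual`) whose first `k` members span
the linear part of the constant value of the section `V` over the tropical chart `e`, together with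
a point `origin` of that affine subspace. -/
structure FlatChart (V : AffineSection K k) (e : TropChart m B) where
  basis : Matrix (Fin m) (Fin m) ℤ
  dual : Matrix (Fin m) (Fin m) ℤ
  origin : Rn m
  basis_mul_dual : basis * dual = 1
  loc_eq : ∀ p ∈ e.1.source, V.loc e p =
    .mk' origin (Submodule.span ℝ ((castMat basis).row '' {i | (i : ℕ) < k}))

theorem AffineSection.IsConstant.nonempty_flatChart (hV : V.IsConstant) (e : TropChart m B) :
    Nonempty (FlatChart V e) := by
  obtain ⟨W, hW, hloc⟩ := hV e
  obtain ⟨ξ, ζ, a, hξζ, rfl⟩ := hW.exists_eq_mk'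
  exact ⟨⟨ξ, ζ, a, hξζ, hloc⟩⟩

namespace FlatChart

variable (c : FlatChart V e) {x : Rn m}

/-- The integral basis, as a real matrix. -/
abbrev ξ : Matrix (Fin m) (Fin m) ℝ := castMat c.basis

/-- The inverse of `ξ`. -/
abbrev ζ : Matrix (Fin m) (Fin m) ℝ := castMat c.dual

theorem ξ_mul_ζ : c.ξ * c.ζ = 1 := castMat_mul_castMat_eq_one c.basis_mul_dual

theorem ζ_transpose_mul_ξ_transpose : c.ζᵀ * c.ξᵀ = 1 := by
  rw [← Matrix.transpose_mul, c.ξ_mul_ζ, Matrix.transpose_one]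

/-- The coordinates of `x̃` with respect to the basis `ξ` and the origin. -/
def flatCoord (x : Rn m) : Rn m := c.ζᵀ *ᵥ (legendre K e x - c.origin)

/-- The base `B(V)` in the tropical coordinates. -/
def slice : Set (Rn m) := zeroSlice e.1.target c.flatCoord {i | (i : ℕ) < k}ᶜ

/-- The columns are the coordinate vector fields, in the coordinates `x`, of the flat coordinates;
this matrix is the inverse of the Jacobian matrix `ζᵀ * hess K e x` of `flatCoord`. -/
def frame (x : Rn m) : Matrix (Fin m) (Fin m) ℝ := (hess K e x)⁻¹ * c.ξᵀ

theorem mem_localBase_iff (hx : x ∈ e.1.target) :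
    e.1.symm x ∈ V.localBase e ↔ x ∈ c.slice := by
  have hp := e.1.map_target hx
  simp only [AffineSection.localBase, Set.mem_ofPred_eq, hp, true_and, c.loc_eq _ hp,
    AffineSubspace.mem_mk', vsub_eq_sub, mem_span_image_row_iff c.ξ_mul_ζ, e.1.right_inv hx, slice,
    zeroSlice, hx, flatCoord, Set.mem_compl_iff, Matrix.mulVec_transpose]

theorem direction_loc (hx : x ∈ e.1.target) : (V.loc e (e.1.symm x)).direction =
    Submodule.span ℝ (c.ξ.row '' {i | (i : ℕ) < k}) := by
  rw [c.loc_eq _ (e.1.map_target hx), AffineSubspace.direction_mk']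

theorem contDiffOn_flatCoord : ContDiffOn ℝ ∞ c.flatCoord e.1.target :=
  (mulVecCLM c.ζᵀ).contDiff.comp_contDiffOn ((contDiffOn_legendre K e).sub contDiffOn_const)

theorem hess_mul_frame (hx : x ∈ e.1.target) : hess K e x * c.frame x = c.ξᵀ := by
  rw [frame, ← Matrix.mul_assoc, Matrix.mul_nonsing_inv _
    ((Matrix.isUnit_iff_isUnit_det _).1 (hess_posDef K e hx).isUnit), Matrix.one_mul]

theorem jacobian_mul_frame (hx : x ∈ e.1.target) :
    c.ζᵀ * hess K e x * c.frame x = 1 := by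
  rw [Matrix.mul_assoc, c.hess_mul_frame hx, c.ζ_transpose_mul_ξ_transpose]

theorem hasFDerivAt_flatCoord (hx : x ∈ e.1.target) : HasFDerivAt c.flatCoord
    (matEquiv (c.jacobian_mul_frame hx) : Rn m →L[ℝ] Rn m) x := by
  have hcomp := (mulVecCLM c.ζᵀ).hasFDerivAt.comp x
    ((hasFDerivAt_legendre K e hx).sub_const c.origin)
  have hmul : mulVecCLM (c.ζᵀ * hess K e x) = (mulVecCLM c.ζᵀ).comp (mulVecCLM (hess K e x)) :=
    ContinuousLinearMap.ext fun v => (Matrix.mulVec_mulVec v _ _).symm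
  rw [coe_matEquiv, hmul]
  exact hcomp

variable [IsTropicalManifold m B] {Y : ∀ p : B, Tan m B p}

theorem setOf_symm_mem_base_eq_slice :
    {x | x ∈ e.1.target ∧ e.1.symm x ∈ V.base} = c.slice := by
  ext x
  have hbase (hx : x ∈ e.1.target) : e.1.symm x ∈ V.base ↔ x ∈ c.slice := by
    rw [AffineSection.mem_base_iff (e.1.map_target hx), c.mem_localBase_iff hx]
  exact ⟨fun h => (hbase h.1).1 h.2, fun h => ⟨h.1, (hbase h.1).2 h⟩⟩

theorem contDiffOn_vecCoord (hY : IsSmoothAlong V Y) : ContDiffOn ℝ ∞ (vecCoord Y e) c.slice :=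
  c.setOf_symm_mem_base_eq_slice ▸ hY e

theorem xRead_lagrangian (Y : ∀ p : B, Tan m B p) : xRead e (lagrangian V Y) =
    fiberedSet e.1.target c.flatCoord (vecCoord Y e) (matEquiv c.ξ_mul_ζ)
      {i | (i : ℕ) < k}ᶜ {i | (i : ℕ) < k} := by
  ext z
  by_cases hz : z.1 ∈ e.1.target
  swap
  · exact iff_of_false (fun h => hz h.1) fun h => hz h.1.1
  refine (and_iff_right hz).trans ((xPoint_mem_lagrangian_iff hz).trans ?_)
  rw [c.mem_localBase_iff hz, c.direction_loc hz]
  simp only [forall_mem_span_image_row_dotProduct_eq_zero_iff,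
    exists_sub_mem_stdLattice_iff c.basis_mul_dual]
  rfl

theorem wRead_complexSub : wRead e (complexSub V) =
    fiberedSet e.1.target c.flatCoord (fun _ => 0) (matEquiv c.ζ_transpose_mul_ξ_transpose)
      {i | (i : ℕ) < k}ᶜ {i | (i : ℕ) < k}ᶜ := by
  have htranspose : c.dualᵀ * c.basisᵀ = 1 := by
    rw [← Matrix.transpose_mul, c.basis_mul_dual, Matrix.transpose_one]
  ext z
  by_cases hz : z.1 ∈ e.1.target
  swap
  · exact iff_of_false (fun h => hz h.1) fun h => hz h.1.1
  refine (and_iff_right hz).trans ((wPoint_mem_complexSub_iff hz).trans ?_)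
  rw [c.mem_localBase_iff hz, c.direction_loc hz]
  simp only [mem_span_image_row_iff c.ξ_mul_ζ, ← Matrix.mulVec_transpose]
  refine and_congr Iff.rfl ((exists_sub_mem_stdLattice_iff htranspose).trans ?_)
  simp only [straighten, sub_zero]
  rfl

end FlatChart

end FlatCharts

/-! ### The submanifolds -/

/-- The inclusion of `ℝᵏ` as the span of the first `k` coordinate vectors of `ℝᵐ`. -/
abbrev headIncl {k m : ℕ} (hk : k ≤ m) : Matrix (Fin m) (Fin k) ℝ :=
  coordIncl (Fin.castLE hk)

theorem headIncl_transpose_mul_headIncl {k m : ℕ} (hk : k ≤ m) :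
    (headIncl hk)ᵀ * headIncl hk = 1 :=
  coordIncl_transpose_mul_coordIncl (Fin.castLE_injective hk)

theorem range_lagrangianModel_castLE {k m : ℕ} (hk : k ≤ m) :
    LinearMap.range (lagrangianModel (Fin.castLE hk)) =
      coordSubspace {i : Fin m | (i : ℕ) < k}ᶜ {i : Fin m | (i : ℕ) < k} := by
  rw [range_lagrangianModel (Fin.castLE_injective hk), Fin.range_castLE]

theorem range_complexModel_castLE {k m : ℕ} (hk : k ≤ m) :
    LinearMap.range (complexModel (Fin.castLE hk)) =
      coordSubspace {i : Fin m | (i : ℕ) < k}ᶜ {i : Fin m | (i : ℕ) < k}ᶜ := by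
  rw [range_complexModel (Fin.castLE_injective hk), Fin.range_castLE]

theorem dz_complexModel {k m : ℕ} (f : Fin k → Fin m) (u : Fin k → ℂ) :
    dz (complexModel f u) = complexMat (coordIncl f) *ᵥ u := by
  rw [← dz_reVec_imVec u, ← dz_mulVec_mulVec, dz_reVec_imVec]
  rfl

section Submanifolds

variable {m : ℕ} {B : Type*} [TopologicalSpace B] [ChartedSpace (Rn m) B]
  {K : ConvexMultivalued m B} {k : ℕ} {V : AffineSection K k} {e : TropChart m B}

theorem FlatChart.zW_eq (c : FlatChart V e) (z : Rn m × Rn m) : zW K e z = complexMat c.ξᵀ *ᵥ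
    dz (straighten c.flatCoord (fun _ => 0) (matEquiv c.ζ_transpose_mul_ξ_transpose) z) +
      complexVec c.origin := by
  have hinv : ∀ s, c.ξᵀ *ᵥ c.ζᵀ *ᵥ s = s := (matEquiv c.ζ_transpose_mul_ξ_transpose).left_inv
  rw [← dz_mulVec_mulVec]
  ext i
  simp only [zW, straighten, flatCoord, sub_zero, matEquiv_apply, hinv, Pi.add_apply, dz,
    Pi.sub_apply, Complex.ofReal_sub]
  ring

variable [IsTropicalManifold m B]

theorem isSubmanifoldX_lagrangian (hk : k ≤ m) (hV : V.IsConstant) {Y : ∀ p : B, Tan m B p}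
    (hY : IsSmoothAlong V Y) : IsSubmanifoldX m (lagrangian V Y) := by
  intro e z hz
  obtain ⟨c⟩ := hV.nonempty_flatChart e
  rw [c.xRead_lagrangian] at hz ⊢
  obtain ⟨O, φ, -, hφ, hzφ, -⟩ := exists_isLocalParam_fiberedSet
    (lagrangianModel_injective (f := Fin.castLE hk))
    (range_lagrangianModel_castLE hk) e.1.open_target c.contDiffOn_flatCoord
    (fun x hx => ⟨_, c.hasFDerivAt_flatCoord hx⟩) (c.contDiffOn_vecCoord hY) hz
  exact ⟨O, φ, hφ, hzφ⟩

theorem isComplexSubmanifold_complexSub (hk : k ≤ m) (hV : V.IsConstant) :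
    IsComplexSubmanifold K k (complexSub V) := by
  intro e z hz
  obtain ⟨c⟩ := hV.nonempty_flatChart e
  rw [c.wRead_complexSub] at hz
  obtain ⟨O, φ, n, hφ, hzφ, hstr⟩ := exists_isLocalParam_fiberedSet
    (complexModel_injective (Fin.castLE_injective hk)) (range_complexModel_castLE hk)
    e.1.open_target c.contDiffOn_flatCoord (fun x hx => ⟨_, c.hasFDerivAt_flatCoord hx⟩)
    contDiffOn_const hz
  have hzW : ∀ u ∈ O, zW K e (φ u) =
      complexMat c.ξᵀ *ᵥ (complexMat (headIncl hk) *ᵥ u + dz (0, n)) +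
        complexVec c.origin := fun u hu => by
    rw [c.zW_eq, hstr u hu, dz_add, dz_complexModel]
  refine ⟨O, φ, ⟨c.wRead_complexSub ▸ hφ, DifferentiableOn.congr ?_ hzW⟩, hzφ⟩
  exact (((complexMat c.ξᵀ).mulVecLin.toContinuousLinearMap.differentiable.comp
    ((complexMat (headIncl hk)).mulVecLin.toContinuousLinearMap.differentiable.add_const
      (dz (0, n)))).add_const _).differentiableOn

end Submanifolds

/-! ### Tangent vectors and the phase matrix -/

/-- `dz` as a linear map. -/
def dzLin {m : ℕ} : Rn m × Rn m →ₗ[ℝ] Fin m → ℂ where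
  toFun := dz
  map_add' := dz_add
  map_smul' r v := by
    ext i
    simp only [dz, Prod.smul_fst, Prod.smul_snd, Pi.smul_apply, smul_eq_mul, Complex.ofReal_mul,
      Real.ringHom_apply, smul_add, Complex.real_smul, add_right_inj]
    ring

section Tangent

variable {m : ℕ} {B : Type*} [TopologicalSpace B] [ChartedSpace (Rn m) B]
  {K : ConvexMultivalued m B} {k : ℕ} {V : AffineSection K k} {e : TropChart m B}

theorem hasFDerivAt_zW_comp {P : Type*} [NormedAddCommGroup P] [NormedSpace ℝ P]
    {φ : P → Rn m × Rn m} {φ' : P →L[ℝ] Rn m × Rn m} {u : P} (hx : (φ u).1 ∈ e.1.target)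
    (hφ : HasFDerivAt φ φ' u) :
    ∃ T : P →L[ℝ] Fin m → ℂ, HasFDerivAt (fun u => zW K e (φ u)) T u ∧
      ∀ v, T v = dz (hess K e (φ u).1 *ᵥ (φ' v).1, (φ' v).2) := by
  have hlegendre : HasFDerivAt (fun u => legendre K e (φ u).1) _ u :=
    HasFDerivAt.comp (f := fun u => (φ u).1) u (hasFDerivAt_legendre K e hx) hφ.fst
  exact ⟨_, dzLin.toContinuousLinearMap.hasFDerivAt.comp u (hlegendre.prodMk hφ.snd), fun _ => rfl⟩

namespace FlatChart

variable (c : FlatChart V e) {Y : ∀ p : B, Tan m B p} (hk : k ≤ m) {x : Rn m}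

theorem ζ_mul_ξ : c.ζ * c.ξ = 1 := mul_eq_one_comm.1 c.ξ_mul_ζ

theorem eq_frame_mulVec (hx : x ∈ e.1.target) {v s : Rn m}
    (h : matEquiv (c.jacobian_mul_frame hx) v = s) : v = c.frame x *ᵥ s :=
  (matEquiv (c.jacobian_mul_frame hx)).eq_symm_apply.2 h

/-- The inverse Hessian of `K` in flat coordinates. -/
def invHess (x : Rn m) : Matrix (Fin m) (Fin m) ℝ := c.ξ * c.frame x

/-- The derivative `∂Y/∂x̃` along `B(V)` in flat coordinates. Only the first `k` columns are
meaningful, as the others differentiate in directions transverse to `B(V)`. -/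
def vecJacobian (Y : ∀ p : B, Tan m B p) (x : Rn m) : Matrix (Fin m) (Fin m) ℝ :=
  c.ξ * (LinearMap.toMatrix' (fderivWithin ℝ (vecCoord Y e) c.slice x : Rn m →ₗ[ℝ] Rn m) *
    c.frame x)

/-- The restriction of the inverse Hessian to the linear part of `V`. -/
def baseInvHess (x : Rn m) : Matrix (Fin k) (Fin k) ℝ :=
  (headIncl hk)ᵀ * c.invHess x * headIncl hk

/-- The restriction of `∂Y/∂x̃` to the linear part of `V`. -/
def baseJacobian (Y : ∀ p : B, Tan m B p) (x : Rn m) : Matrix (Fin k) (Fin k) ℝ :=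
  (headIncl hk)ᵀ * c.vecJacobian Y x * headIncl hk

/-- The matrix of `ω̃ + F` along `C(V)`; its determinant carries the phase both of `L(V,Y)` and of
`D^Y`. -/
def phaseMat (Y : ∀ p : B, Tan m B p) (x : Rn m) : Matrix (Fin k) (Fin k) ℂ :=
  complexMat (c.baseInvHess hk x) + Complex.I • complexMat (c.baseJacobian hk Y x)

theorem ζ_mul_invHess (x : Rn m) : c.ζ * c.invHess x = c.frame x := by
  rw [invHess, ← Matrix.mul_assoc, c.ζ_mul_ξ, Matrix.one_mul]

/-- The matrix of `dz` on the tangent spaces of `L(V,Y)`, in flat coordinates. -/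
def tangentMat (Y : ∀ p : B, Tan m B p) (x : Rn m) : Matrix (Fin m) (Fin m) ℂ :=
  complexMat c.ζ * ((complexMat (c.invHess x) + Complex.I • complexMat (c.vecJacobian Y x)) *
    (complexMat (headIncl hk) * complexMat (headIncl hk)ᵀ) +
      Complex.I • (1 - complexMat (headIncl hk) * complexMat (headIncl hk)ᵀ))

theorem det_tangentMat (Y : ∀ p : B, Tan m B p) (x : Rn m) : (c.tangentMat hk Y x).det =
    Complex.I ^ (m - k) * (c.phaseMat hk Y x).det * (c.ζ.det : ℝ) := by
  have hleft : complexMat (headIncl hk)ᵀ * complexMat (headIncl hk) = 1 := by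
    rw [← complexMat_mul, headIncl_transpose_mul_headIncl, complexMat_one]
  rw [tangentMat, Matrix.det_mul, det_complexMat,
    det_mul_mul_add_smul_one_sub Complex.I_ne_zero (by simpa) _ hleft, Fintype.card_fin,
    Fintype.card_fin, mul_comm, Matrix.mul_add, Matrix.add_mul, Matrix.mul_smul, Matrix.smul_mul]
  simp only [phaseMat, baseInvHess, baseJacobian, complexMat_mul]

theorem dz_eq_tangentMat_mulVec (Y : ∀ p : B, Tan m B p) (x s : Rn m) :
    dz (c.frame x *ᵥ coordProj (Fin.castLE hk) *ᵥ s,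
      c.ζ *ᵥ (c.vecJacobian Y x *ᵥ coordProj (Fin.castLE hk) *ᵥ s +
        (1 - coordProj (Fin.castLE hk)) *ᵥ s)) = c.tangentMat hk Y x *ᵥ complexVec s := by
  rw [← c.ζ_mul_invHess, ← Matrix.mulVec_mulVec, Matrix.mulVec_mulVec _ (c.invHess x),
    Matrix.mulVec_mulVec _ (c.vecJacobian Y x), ← Matrix.add_mulVec, dz_mulVec_mulVec c.ζ (_, _),
    dz_mulVec, Matrix.mulVec_mulVec, tangentMat, coordProj]
  simp only [complexMat_mul, complexMat_add, complexMat_sub, complexMat_one, Matrix.add_mul,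
    Matrix.smul_mul, smul_add, add_assoc]

theorem dotProduct_ξ_transpose_mulVec_headIncl_mulVec (w : Rn m) (q : Rn k) :
    w ⬝ᵥ c.ξᵀ *ᵥ headIncl hk *ᵥ q = q ⬝ᵥ (headIncl hk)ᵀ *ᵥ c.ξ *ᵥ w := by
  rw [Matrix.dotProduct_transpose_mulVec, Matrix.dotProduct_transpose_mulVec, dotProduct_comm]

theorem omegaW_eq (x : Rn m) (s t s' t' : Rn k) :
    omegaW (c.frame x *ᵥ headIncl hk *ᵥ s, c.ξᵀ *ᵥ headIncl hk *ᵥ t)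
      (c.frame x *ᵥ headIncl hk *ᵥ s', c.ξᵀ *ᵥ headIncl hk *ᵥ t') =
      t' ⬝ᵥ c.baseInvHess hk x *ᵥ s - t ⬝ᵥ c.baseInvHess hk x *ᵥ s' := by
  have hdot : ∀ v w : Rn m × Rn m, omegaW v w = v.1 ⬝ᵥ w.2 - w.1 ⬝ᵥ v.2 := fun v w =>
    Finset.sum_sub_distrib ..
  rw [hdot, c.dotProduct_ξ_transpose_mulVec_headIncl_mulVec,
    c.dotProduct_ξ_transpose_mulVec_headIncl_mulVec]
  simp only [baseInvHess, invHess, Matrix.mulVec_mulVec, Matrix.mul_assoc]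

theorem fderivWithin_vecCoord_frame_mulVec (Y : ∀ p : B, Tan m B p) (x s : Rn m) :
    fderivWithin ℝ (vecCoord Y e) c.slice x (c.frame x *ᵥ s) = c.ζ *ᵥ c.vecJacobian Y x *ᵥ s := by
  rw [vecJacobian, ← Matrix.mulVec_mulVec, ← Matrix.mulVec_mulVec, Matrix.mulVec_mulVec _ c.ζ,
    c.ζ_mul_ξ, Matrix.one_mulVec, LinearMap.toMatrix'_mulVec]
  rfl

variable [IsTropicalManifold m B]

theorem hasFDerivWithinAt_vecCoord (hY : IsSmoothAlong V Y) (hx : x ∈ c.slice) :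
    HasFDerivWithinAt (vecCoord Y e) (fderivWithin ℝ (vecCoord Y e) c.slice x) c.slice x :=
  ((c.contDiffOn_vecCoord hY x hx).differentiableWithinAt (by simp)).hasFDerivWithinAt

theorem fst_mem_slice_of_mem_lagrangian {z : Rn m × Rn m} (hz : z ∈ xRead e (lagrangian V Y)) :
    z.1 ∈ c.slice := by
  rw [c.xRead_lagrangian] at hz
  exact hz.1

theorem fst_mem_slice_of_mem_complexSub {z : Rn m × Rn m} (hz : z ∈ wRead e (complexSub V)) :
    z.1 ∈ c.slice := by
  rw [c.wRead_complexSub] at hz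
  exact hz.1

theorem exists_linearEquiv_fderiv_lagrangian {O : Set (Rn m)} {φ : Rn m → Rn m × Rn m} {u : Rn m}
    (hY : IsSmoothAlong V Y) (hφ : IsLocalParam (xRead e (lagrangian V Y)) O φ) (hu : u ∈ O) :
    ∃ M : Rn m ≃ₗ[ℝ] Rn m, ∀ v, fderiv ℝ φ u v =
      (c.frame (φ u).1 *ᵥ coordProj (Fin.castLE hk) *ᵥ M v,
        c.ζ *ᵥ (c.vecJacobian Y (φ u).1 *ᵥ coordProj (Fin.castLE hk) *ᵥ M v +
          (1 - coordProj (Fin.castLE hk)) *ᵥ M v)) := by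
  have hslice := c.fst_mem_slice_of_mem_lagrangian (hφ.mapsTo hu)
  rw [c.xRead_lagrangian] at hφ
  obtain ⟨M, hM⟩ := hφ.exists_linearEquiv_straighten_fderiv lagrangianModel_injective
    (range_lagrangianModel_castLE hk) hu (c.hasFDerivAt_flatCoord hslice.1)
    (matEquiv (c.jacobian_mul_frame hslice.1)).injective (c.hasFDerivWithinAt_vecCoord hY hslice)
  refine ⟨M, fun v => ?_⟩
  obtain ⟨hbase, hfibre⟩ := Prod.ext_iff.1 (hM v)
  have hbase : (fderiv ℝ φ u v).1 = c.frame (φ u).1 *ᵥ coordProj (Fin.castLE hk) *ᵥ M v :=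
    c.eq_frame_mulVec hslice.1 hbase
  have hfibre : (fderiv ℝ φ u v).2 - fderivWithin ℝ (vecCoord Y e) c.slice (φ u).1
      (fderiv ℝ φ u v).1 = c.ζ *ᵥ (1 - coordProj (Fin.castLE hk)) *ᵥ M v :=
    (matEquiv c.ξ_mul_ζ).eq_symm_apply.2 hfibre
  refine Prod.ext hbase ((sub_eq_iff_eq_add'.1 hfibre).trans ?_)
  rw [hbase, c.fderivWithin_vecCoord_frame_mulVec, Matrix.mulVec_add]

theorem exists_linearEquiv_fderiv_complexSub {O : Set (Fin k → ℂ)}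
    {φ : (Fin k → ℂ) → Rn m × Rn m} {u : Fin k → ℂ}
    (hφ : IsLocalParam (wRead e (complexSub V)) O φ) (hu : u ∈ O) :
    ∃ M : (Fin k → ℂ) ≃ₗ[ℝ] (Fin k → ℂ), ∀ v, fderiv ℝ φ u v =
      (c.frame (φ u).1 *ᵥ headIncl hk *ᵥ reVec (M v), c.ξᵀ *ᵥ headIncl hk *ᵥ imVec (M v)) := by
  have hslice := c.fst_mem_slice_of_mem_complexSub (hφ.mapsTo hu)
  rw [c.wRead_complexSub] at hφ
  obtain ⟨M, hM⟩ := hφ.exists_linearEquiv_straighten_fderiv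
    (complexModel_injective (Fin.castLE_injective hk)) (range_complexModel_castLE hk) hu
    (c.hasFDerivAt_flatCoord hslice.1) (matEquiv (c.jacobian_mul_frame hslice.1)).injective
    (hasFDerivWithinAt_const _ _ _)
  refine ⟨M, fun v => ?_⟩
  obtain ⟨hbase, hfibre⟩ := Prod.ext_iff.1 (hM v)
  refine Prod.ext (c.eq_frame_mulVec hslice.1 hbase) ?_
  rw [← sub_zero (fderiv ℝ φ u v).2]
  exact (matEquiv c.ζ_transpose_mul_ξ_transpose).eq_symm_apply.2 hfibre

theorem exists_linearEquiv_fderiv_holParam {O : Set (Fin k → ℂ)}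
    {φ : (Fin k → ℂ) → Rn m × Rn m} {u : Fin k → ℂ}
    (hφ : IsHolParam K (complexSub V) e O φ) (hu : u ∈ O) :
    ∃ M : (Fin k → ℂ) ≃ₗ[ℝ] (Fin k → ℂ), (∀ v, M (Complex.I • v) = Complex.I • M v) ∧
      ∀ v, fderiv ℝ φ u v =
        (c.frame (φ u).1 *ᵥ headIncl hk *ᵥ reVec (M v), c.ξᵀ *ᵥ headIncl hk *ᵥ imVec (M v)) := by
  obtain ⟨hφ, hhol⟩ := hφ
  obtain ⟨M, hM⟩ := c.exists_linearEquiv_fderiv_complexSub hk hφ hu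
  refine ⟨M, fun v => ?_, hM⟩
  have hx : (φ u).1 ∈ e.1.target := (hφ.mapsTo hu).1
  obtain ⟨T, hT, hTφ⟩ := hasFDerivAt_zW_comp (K := K) hx (hφ.hasFDerivAt hu)
  have hTM : ∀ v, T v = complexMat (c.ξᵀ * headIncl hk) *ᵥ M v := fun v => by
    conv_rhs => rw [← dz_reVec_imVec (M v), ← dz_mulVec_mulVec]
    rw [hTφ, hM]
    simp only [Matrix.mulVec_mulVec, ← Matrix.mul_assoc, c.hess_mul_frame hx]
  have hTI : T (Complex.I • v) = Complex.I • T v := by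
    have hhol' := (hhol.differentiableAt (hφ.isOpen.mem_nhds hu)).hasFDerivAt
    rw [hT.unique (hhol'.restrictScalars ℝ)]
    exact map_smul (fderiv ℂ (fun u => zW K e (φ u)) u) Complex.I v
  have hleft : ((headIncl hk)ᵀ * c.ζᵀ) * (c.ξᵀ * headIncl hk) = 1 := by
    rw [Matrix.mul_assoc, ← Matrix.mul_assoc c.ζᵀ, c.ζ_transpose_mul_ξ_transpose, Matrix.one_mul,
      headIncl_transpose_mul_headIncl]
  have hcomm : complexMat (c.ξᵀ * headIncl hk) *ᵥ M (Complex.I • v) =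
      complexMat (c.ξᵀ * headIncl hk) *ᵥ (Complex.I • M v) := by
    rw [← hTM, hTI, hTM, Matrix.mulVec_smul]
  simpa only [Matrix.mulVec_mulVec, ← complexMat_mul, hleft, complexMat_one, Matrix.one_mulVec]
    using congrArg (complexMat ((headIncl hk)ᵀ * c.ζᵀ) *ᵥ ·) hcomm

theorem omegaX_eq_zero_iff (hY : IsSmoothAlong V Y) {O : Set (Rn m)} {φ : Rn m → Rn m × Rn m}
    {u : Rn m} (hφ : IsLocalParam (xRead e (lagrangian V Y)) O φ) (hu : u ∈ O) :
    (∀ a b, omegaX K e (φ u) (fderiv ℝ φ u a) (fderiv ℝ φ u b) = 0) ↔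
      (c.baseJacobian hk Y (φ u).1).IsSymm := by
  have hx : (φ u).1 ∈ e.1.target := (hφ.mapsTo hu).1
  obtain ⟨M, hM⟩ := c.exists_linearEquiv_fderiv_lagrangian hk hY hφ hu
  have hpair : ∀ a b, (hess K e (φ u).1 *ᵥ (fderiv ℝ φ u a).1) ⬝ᵥ (fderiv ℝ φ u b).2 =
      ((headIncl hk)ᵀ *ᵥ M a) ⬝ᵥ
        c.baseJacobian hk Y (φ u).1 *ᵥ (headIncl hk)ᵀ *ᵥ M b := fun a b => by
    rw [hM, hM, Matrix.mulVec_mulVec, c.hess_mul_frame hx, Matrix.mulVec_transpose,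
      ← Matrix.dotProduct_mulVec, Matrix.mulVec_mulVec _ c.ξ, c.ξ_mul_ζ, Matrix.one_mulVec,
      coordProj, ← Matrix.mulVec_mulVec, ← Matrix.vecMul_transpose, ← Matrix.dotProduct_mulVec]
    simp only [Matrix.mulVec_add, Matrix.mulVec_mulVec, Matrix.mul_sub, Matrix.mul_one,
      baseJacobian, ← Matrix.mul_assoc, headIncl_transpose_mul_headIncl, Matrix.one_mul, sub_self,
      Matrix.zero_mulVec, add_zero]
  have hsurj : Function.Surjective fun a => (headIncl hk)ᵀ *ᵥ M a := fun s =>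
    ⟨M.symm (headIncl hk *ᵥ s), by simp [headIncl_transpose_mul_headIncl]⟩
  simp only [omegaX_eq K e hx, hpair, Complex.ofReal_eq_zero, sub_eq_zero]
  rw [isSymm_iff_dotProduct_mulVec_comm, hsurj.forall₂]

theorem im_OmegaX_eq_zero_iff (hY : IsSmoothAlong V Y) {O : Set (Rn m)}
    {φ : Rn m → Rn m × Rn m} {u : Rn m} (hφ : IsLocalParam (xRead e (lagrangian V Y)) O φ)
    (hu : u ∈ O) (t : ℂ) :
    (∀ a : Fin m → Rn m, (t * OmegaX fun j => fderiv ℝ φ u (a j)).im = 0) ↔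
      (t * Complex.I ^ (m - k) * (c.phaseMat hk Y (φ u).1).det).im = 0 := by
  obtain ⟨M, hM⟩ := c.exists_linearEquiv_fderiv_lagrangian hk hY hφ hu
  have hdz : ∀ a, dz (fderiv ℝ φ u a) = c.tangentMat hk Y (φ u).1 *ᵥ complexVec (M a) := fun a =>
    (congrArg dz (hM a)).trans (c.dz_eq_tangentMat_mulVec hk Y _ _)
  have hdet : c.ζ.det ≠ 0 := fun h => by
    simpa [h] using congrArg Matrix.det c.ζ_mul_ξ
  rw [forall_im_mul_OmegaX_eq_zero_iff M.surjective hdz, c.det_tangentMat, ← mul_assoc,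
    ← mul_assoc, im_mul_ofReal_eq_zero_iff hdet]

theorem curvature_eq (hY : IsSmoothAlong V Y) {O : Set (Fin k → ℂ)}
    {φ : (Fin k → ℂ) → Rn m × Rn m} {u v w : Fin k → ℂ} {s t s' t' : Rn k}
    (hφ : IsLocalParam (wRead e (complexSub V)) O φ) (hu : u ∈ O)
    (hv : fderiv ℝ φ u v = (c.frame (φ u).1 *ᵥ headIncl hk *ᵥ s, c.ξᵀ *ᵥ headIncl hk *ᵥ t))
    (hw : fderiv ℝ φ u w = (c.frame (φ u).1 *ᵥ headIncl hk *ᵥ s', c.ξᵀ *ᵥ headIncl hk *ᵥ t')) :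
    curvature (pullback (connForm Y e) φ) u v w = Complex.I *
      ((t' ⬝ᵥ c.baseJacobian hk Y (φ u).1 *ᵥ s - t ⬝ᵥ c.baseJacobian hk Y (φ u).1 *ᵥ s' : ℝ) :
        ℂ) := by
  have hslice : ∀ᶠ u in 𝓝 u, (φ u).1 ∈ c.slice :=
    (hφ.eventually_mem hu).mono fun _ => c.fst_mem_slice_of_mem_complexSub
  have hL : HasFDerivAt (fun u => vecCoord Y e (φ u).1) _ u :=
    HasFDerivWithinAt.comp_hasFDerivAt (f := fun u => (φ u).1) u
      (c.hasFDerivWithinAt_vecCoord hY hslice.self_of_nhds) (hφ.hasFDerivAt hu).fst hslice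
  have hvec : ∀ s, c.ξ *ᵥ fderivWithin ℝ (vecCoord Y e) c.slice (φ u).1
      (c.frame (φ u).1 *ᵥ headIncl hk *ᵥ s) = c.vecJacobian Y (φ u).1 *ᵥ headIncl hk *ᵥ s :=
    fun s => by
      rw [c.fderivWithin_vecCoord_frame_mulVec, Matrix.mulVec_mulVec, c.ξ_mul_ζ,
        Matrix.one_mulVec]
  have hsmooth : ContDiffAt ℝ 2 φ u :=
    (hφ.smooth.contDiffAt (hφ.isOpen.mem_nhds hu)).of_le (by norm_cast)
  rw [curvature_pullback_connForm hsmooth hL]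
  simp only [ContinuousLinearMap.comp_apply, ContinuousLinearMap.coe_fst', hv, hw,
    c.dotProduct_ξ_transpose_mulVec_headIncl_mulVec, hvec]
  simp only [baseJacobian, Matrix.mulVec_mulVec, Matrix.mul_assoc]

theorem part02_curvature_eq_zero_iff (hY : IsSmoothAlong V Y) {O : Set (Fin k → ℂ)}
    {φ : (Fin k → ℂ) → Rn m × Rn m} {u : Fin k → ℂ}
    (hφ : IsHolParam K (complexSub V) e O φ) (hu : u ∈ O) :
    (∀ a b, part02 (curvature (pullback (connForm Y e) φ) u) a b = 0) ↔
      (c.baseJacobian hk Y (φ u).1).IsSymm := by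
  obtain ⟨M, hI, hM⟩ := c.exists_linearEquiv_fderiv_holParam hk hφ hu
  simp only [part02, c.curvature_eq hk hY hφ.1 hu (hM _) (hM _), hI, reVec_I_smul, imVec_I_smul,
    isSymm_iff_dotProduct_mulVec_comm]
  refine ⟨fun h s t => ?_, fun h a b => ?_⟩
  · obtain ⟨a, ha, ha'⟩ := exists_reVec_eq_imVec_eq t (0 : Rn k)
    obtain ⟨b, hb, hb'⟩ := exists_reVec_eq_imVec_eq (0 : Rn k) s
    have him := congrArg Complex.im (h (M.symm a) (M.symm b))
    simpa [ha, ha', hb, hb', Matrix.mulVec_neg, sub_eq_zero] using him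
  · rw [h (imVec (M b)) (reVec (M a)), h (imVec (M a)) (reVec (M b))]
    simp only [Matrix.mulVec_neg, dotProduct_neg]
    rw [h (reVec (M b)) (reVec (M a)), h (imVec (M b)) (imVec (M a))]
    push_cast
    ring

theorem im_wedgePow_eq_zero_iff (hY : IsSmoothAlong V Y) {O : Set (Fin k → ℂ)}
    {φ : (Fin k → ℂ) → Rn m × Rn m} {u : Fin k → ℂ}
    (hφ : IsHolParam K (complexSub V) e O φ) (hu : u ∈ O) (t : ℂ) :
    (∀ v : Fin k × Fin 2 → (Fin k → ℂ), (t * wedgePow k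
        (fun a b => (omegaW (fderiv ℝ φ u a) (fderiv ℝ φ u b) : ℂ)
          + curvature (pullback (connForm Y e) φ) u a b) v).im = 0) ↔
      (t * (c.phaseMat hk Y (φ u).1).det).im = 0 := by
  obtain ⟨M, -, hM⟩ := c.exists_linearEquiv_fderiv_holParam hk hφ hu
  let coord : (Fin k → ℂ) → Fin k × Fin 2 → ℝ := fun v s =>
    ![reVec (M v) s.1, imVec (M v) s.1] s.2
  have hcoord : Function.Surjective coord := fun d => by
    obtain ⟨a, ha, ha'⟩ := exists_reVec_eq_imVec_eq (fun i => d (i, 0)) fun i => d (i, 1)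
    refine ⟨M.symm a, funext fun ⟨i, j⟩ => ?_⟩
    fin_cases j <;> simp [coord, ha, ha']
  have hform : ∀ a b, (omegaW (fderiv ℝ φ u a) (fderiv ℝ φ u b) : ℂ) +
      curvature (pullback (connForm Y e) φ) u a b =
      pairForm (c.phaseMat hk Y (φ u).1)ᵀ (complexVec (coord a)) (complexVec (coord b)) :=
    fun a b => by
      rw [c.curvature_eq hk hY hφ.1 hu (hM a) (hM b), hM, hM, c.omegaW_eq, pairForm_apply,
        Matrix.dotProduct_transpose_mulVec, Matrix.dotProduct_transpose_mulVec]
      change _ = complexVec (imVec (M b)) ⬝ᵥ _ *ᵥ complexVec (reVec (M a)) -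
        complexVec (imVec (M a)) ⬝ᵥ _ *ᵥ complexVec (reVec (M b))
      simp only [phaseMat, Matrix.add_mulVec, Matrix.smul_mulVec, complexMat_mulVec_complexVec,
        dotProduct_add, dotProduct_smul, complexVec_dotProduct, smul_eq_mul]
      push_cast
      ring
  rw [forall_im_mul_wedgePow_eq_zero_iff hcoord hform, Matrix.det_transpose]

end FlatChart

end Tangent

/-! ### The mirror correspondence -/

section Correspondence

variable {m : ℕ} {B : Type*} [TopologicalSpace B] [ChartedSpace (Rn m) B]
  {K : ConvexMultivalued m B} {k : ℕ} {V : AffineSection K k} {Y : ∀ p : B, Tan m B p}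

theorem exp_neg_I_mul_add_pi_div_two (θ : ℝ) (n : ℕ) :
    Complex.exp (-(Complex.I * ((θ + n * (Real.pi / 2) : ℝ) : ℂ))) =
      Complex.exp (-(Complex.I * (θ : ℂ))) * (-Complex.I) ^ n := by
  rw [← Complex.exp_neg_pi_div_two_mul_I, ← Complex.exp_nat_mul, ← Complex.exp_add]
  congr 1
  push_cast
  ring

theorem isSpecialLagrangian_add_pi_div_two_iff {n : ℕ} (hn : Even n) (θ : ℝ)
    (L : Set (XB m B)) :
    IsSpecialLagrangian K (θ + n * (Real.pi / 2)) L ↔ IsSpecialLagrangian K θ L := by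
  obtain ⟨r, rfl⟩ := hn
  have hreal : (-Complex.I) ^ (r + r) = (((-1) ^ r : ℝ) : ℂ) := by
    rw [pow_add, ← mul_pow, neg_mul_neg, Complex.I_mul_I]
    push_cast
    rfl
  have hne : (-1 : ℝ) ^ r ≠ 0 := pow_ne_zero _ (by norm_num)
  rw [IsSpecialLagrangian, IsSpecialLagrangian]
  refine and_congr Iff.rfl (forall₅_congr fun e O φ _ u => forall₂_congr fun hu a => ?_)
  rw [exp_neg_I_mul_add_pi_div_two, hreal, mul_right_comm, im_mul_ofReal_eq_zero_iff hne]

variable [IsTropicalManifold m B]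

theorem forall_isLocalParam_lagrangian_iff (hk : k ≤ m) (hV : V.IsConstant)
    (hY : IsSmoothAlong V Y) (c : ∀ e : TropChart m B, FlatChart V e)
    (P : TropChart m B → Rn m → Prop) :
    (∀ (e : TropChart m B) (O : Set (Rn m)) (φ : Rn m → Rn m × Rn m),
      IsLocalParam (xRead e (lagrangian V Y)) O φ → ∀ u ∈ O, P e (φ u).1) ↔
      ∀ e, ∀ x ∈ (c e).slice, P e x := by
  refine ⟨fun h e x hx => ?_, fun h e O φ hφ u hu =>
    h e _ ((c e).fst_mem_slice_of_mem_lagrangian (hφ.mapsTo hu))⟩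
  have hmem : (x, vecCoord Y e x) ∈ xRead e (lagrangian V Y) := by
    rw [(c e).xRead_lagrangian]
    exact ⟨hx, fun i _ => ⟨0, by simp [straighten]⟩⟩
  obtain ⟨O, φ, hφ, u, hu, hφu⟩ := isSubmanifoldX_lagrangian hk hV hY e _ hmem
  simpa only [hφu] using h e O φ hφ u hu

theorem forall_isHolParam_complexSub_iff (hk : k ≤ m) (hV : V.IsConstant)
    (c : ∀ e : TropChart m B, FlatChart V e) (P : TropChart m B → Rn m → Prop) :
    (∀ (e : TropChart m B) (O : Set (Fin k → ℂ)) (φ : (Fin k → ℂ) → Rn m × Rn m),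
      IsHolParam K (complexSub V) e O φ → ∀ u ∈ O, P e (φ u).1) ↔
      ∀ e, ∀ x ∈ (c e).slice, P e x := by
  refine ⟨fun h e x hx => ?_, fun h e O φ hφ u hu =>
    h e _ ((c e).fst_mem_slice_of_mem_complexSub (hφ.1.mapsTo hu))⟩
  have hmem : (x, 0) ∈ wRead e (complexSub V) := by
    rw [(c e).wRead_complexSub]
    exact ⟨hx, fun i _ => ⟨0, by simp [straighten]⟩⟩
  obtain ⟨O, φ, hφ, u, hu, hφu⟩ := isComplexSubmanifold_complexSub hk hV e _ hmem
  simpa only [hφu] using h e O φ hφ u hu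

theorem isLagrangian_iff_forall_baseJacobian_isSymm (hk : k ≤ m) (hV : V.IsConstant)
    (hY : IsSmoothAlong V Y) (c : ∀ e : TropChart m B, FlatChart V e) :
    IsLagrangian K (lagrangian V Y) ↔
      ∀ e, ∀ x ∈ (c e).slice, ((c e).baseJacobian hk Y x).IsSymm := by
  rw [IsLagrangian, and_iff_right (isSubmanifoldX_lagrangian hk hV hY),
    ← forall_isLocalParam_lagrangian_iff hk hV hY c]
  exact forall₅_congr fun e O φ hφ u => forall_congr' fun hu =>
    (c e).omegaX_eq_zero_iff hk hY hφ hu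

theorem isIntegrable_iff_forall_baseJacobian_isSymm (hk : k ≤ m) (hV : V.IsConstant)
    (hY : IsSmoothAlong V Y) (c : ∀ e : TropChart m B, FlatChart V e) :
    IsIntegrable k K (complexSub V) (connForm Y) ↔
      ∀ e, ∀ x ∈ (c e).slice, ((c e).baseJacobian hk Y x).IsSymm := by
  rw [IsIntegrable, ← forall_isHolParam_complexSub_iff hk hV c]
  exact forall₅_congr fun e O φ hφ u => forall_congr' fun hu =>
    (c e).part02_curvature_eq_zero_iff hk hY hφ hu

theorem isLagrangian_iff_isIntegrable (hk : k ≤ m) (hV : V.IsConstant)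
    (hY : IsSmoothAlong V Y) :
    IsLagrangian K (lagrangian V Y) ↔ IsIntegrable k K (complexSub V) (connForm Y) := by
  obtain ⟨c⟩ := Classical.nonempty_pi.2 hV.nonempty_flatChart
  rw [isLagrangian_iff_forall_baseJacobian_isSymm hk hV hY c,
    isIntegrable_iff_forall_baseJacobian_isSymm hk hV hY c]

theorem isSpecialLagrangian_iff_forall_im_det_phaseMat (hk : k ≤ m) (hV : V.IsConstant)
    (hY : IsSmoothAlong V Y) (c : ∀ e : TropChart m B, FlatChart V e) (θ : ℝ) :
    IsSpecialLagrangian K (θ + ((m : ℝ) - (k : ℝ)) * (Real.pi / 2)) (lagrangian V Y) ↔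
      IsLagrangian K (lagrangian V Y) ∧ ∀ e, ∀ x ∈ (c e).slice,
        (Complex.exp (-(Complex.I * (θ : ℂ))) * ((c e).phaseMat hk Y x).det).im = 0 := by
  rw [IsSpecialLagrangian, ← forall_isLocalParam_lagrangian_iff hk hV hY c]
  refine and_congr_right' (forall₅_congr fun e O φ hφ u => forall_congr' fun hu => ?_)
  rw [(c e).im_OmegaX_eq_zero_iff hk hY hφ hu, ← Nat.cast_sub hk, exp_neg_I_mul_add_pi_div_two,
    mul_assoc _ _ (Complex.I ^ _), ← mul_pow, neg_mul, Complex.I_mul_I, neg_neg, one_pow, mul_one]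

theorem isDHYM_iff_forall_im_det_phaseMat (hk : k ≤ m) (hV : V.IsConstant)
    (hY : IsSmoothAlong V Y) (c : ∀ e : TropChart m B, FlatChart V e) (θ : ℝ) :
    IsDHYM k K θ (complexSub V) (connForm Y) ↔
      IsIntegrable k K (complexSub V) (connForm Y) ∧ ∀ e, ∀ x ∈ (c e).slice,
        (Complex.exp (-(Complex.I * (θ : ℂ))) * ((c e).phaseMat hk Y x).det).im = 0 := by
  rw [IsDHYM, ← forall_isHolParam_complexSub_iff hk hV c]
  exact and_congr_right' (forall₅_congr fun e O φ hφ u => forall_congr' fun hu =>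
    (c e).im_wedgePow_eq_zero_iff hk hY hφ hu _)

theorem isSpecialLagrangian_iff_isDHYM (hk : k ≤ m) (hV : V.IsConstant)
    (hY : IsSmoothAlong V Y) (θ : ℝ) :
    IsSpecialLagrangian K (θ + ((m : ℝ) - (k : ℝ)) * (Real.pi / 2)) (lagrangian V Y) ↔
      IsDHYM k K θ (complexSub V) (connForm Y) := by
  obtain ⟨c⟩ := Classical.nonempty_pi.2 hV.nonempty_flatChart
  rw [isSpecialLagrangian_iff_forall_im_det_phaseMat hk hV hY c,
    isDHYM_iff_forall_im_det_phaseMat hk hV hY c, isLagrangian_iff_isIntegrable hk hV hY]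

end Correspondence

end

end TropicalMirror

theorem mainTheorem1 {m k : ℕ} (hk : k ≤ m) {B : Type*} [TopologicalSpace B]
    [ChartedSpace (Rn m) B] [IsTropicalManifold m B]
    (K : ConvexMultivalued m B) (V : AffineSection K k) (hV : V.IsConstant)
    (Y : ∀ p : B, Tan m B p) (hY : IsSmoothAlong V Y) :
    IsSubmanifoldX m (lagrangian V Y) ∧
    IsComplexSubmanifold K k (complexSub V) ∧
    (IsLagrangian K (lagrangian V Y) ↔ IsIntegrable k K (complexSub V) (connForm Y)) ∧
    (∀ θ : ℝ, IsSpecialLagrangian K (θ + ((m : ℝ) - (k : ℝ)) * (Real.pi / 2)) (lagrangian V Y) ↔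
      IsDHYM k K θ (complexSub V) (connForm Y)) ∧
    (Even (m - k) → ∀ θ : ℝ, IsSpecialLagrangian K θ (lagrangian V Y) ↔
      IsDHYM k K θ (complexSub V) (connForm Y)) := by
  refine ⟨isSubmanifoldX_lagrangian hk hV hY, isComplexSubmanifold_complexSub hk hV,
    isLagrangian_iff_isIntegrable hk hV hY, isSpecialLagrangian_iff_isDHYM hk hV hY,
    fun heven θ => ?_⟩
  rw [← isSpecialLagrangian_iff_isDHYM hk hV hY, ← Nat.cast_sub hk,
    isSpecialLagrangian_add_pi_div_two_iff heven]
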